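/- **Setting.** Let $d\ge 1$ and let $\mu$ be a probability measure on $\mathbb R^d$, the known prior of a parameter $\ell^*$. A bandit algorithm with horizon $T$ recommends in each round $t=1,\dots,T$ an action $A^{(t)}$ in the closed Euclidean unit ball of $\mathbb R^d$; the action is a measurable function of the previously observed rewards and of external randomness independent of $\ell^*$ and of the noise. It then observes $r^{(t)}=\langle A^{(t)},\ell^*\rangle+w_t$ with i.i.d. noise $w_t\sim N(0,1)$ independent of $\ell^*$. The algorithm is *Bayesian incentive compatible (BIC)* if for every $t\le T$, almost surely, $\mathbb E[\langle \ell^*,a\rangle\mid A^{(t)}]$ is maximized over all $a$ in the unit ball by $a=A^{(t)}$. It achieves *$\lambda$-spectral exploration* if almost surely $\sum_{t=1}^T A^{(t)}(A^{(t)})^{\top}\succeq\lambda I$. Repeating an algorithm $N$ times means running it $N$ times in succession, each run with fresh external randomness and using only the rewards of that run. **Assumption.** For constants $c_d,\epsilon_d,\sigma,K>0$ and every unit vector $v$: $\Pr(\langle v,\ell^*\rangle\ge c_d)\ge\epsilon_d$; $\mathrm{Var}(\langle v,\ell^*\rangle)\ge\sigma$; and $\Pr(|\langle v,\ell^*\rangle|\ge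 t)\le 2e^{-t^2/K^2}$ for all $t>0$. **Theorem.** There is an absolute exponent $p\in\mathbb N$, and for every $K>0$ there is a constant $C=C(K)>0$, such that the following holds for all $d\ge1$ and all $\mu,c_d,\epsilon_d,\sigma$ satisfying the assumption. 1. For every $\lambda$ with $0<\lambda\le\min(1,\sigma/d)$ there is a BIC algorithm that achieves $\lambda$-spectral exploration and whose number of rounds is at most $$C\,\max\Big(1,\log\frac1{\sigma\epsilon_dc_d}\Big)\Big(\frac{d^5}{\lambda^4\sigma^2}+\frac{d^4}{c_d^2\lambda^4}\Big).$$ Moreover, for every $\bar\lambda>0$, this algorithm repeated $\lceil\bar\lambda/\lambda\rceil$ times is BIC and achieves $\bar\lambda$-spectral exploration. 2. For every $\bar\lambda>0$ there is a BIC algorithm that achieves $\bar\lambda$-spectral exploration in at most $$C\,\max(1,\bar\lambda)\Big(\frac{d}{\min(\sigma,c_d)}\Big)^{p}\log\frac1{\epsilon_d}$$ rounds. -/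

import Mathlib

open MeasureTheory ProbabilityTheory

noncomputable section

/-- `ℓ* ~ μ` on `ℝ^d` is not confined to a half-space (constants `c`, `ε`), has covariance
bounded below by `σ`, and is sub-gaussian with constant `K`. -/
structure PriorAssumption {d : ℕ} (μ : Measure (EuclideanSpace ℝ (Fin d)))
    (c ε σ K : ℝ) : Prop where
  c_pos : 0 < c
  ε_pos : 0 < ε
  σ_pos : 0 < σ
  K_pos : 0 < K
  halfspace : ∀ v : EuclideanSpace ℝ (Fin d), ‖v‖ = 1 → ε ≤ μ.real {x | c ≤ inner ℝ v x}
  covariance : ∀ v : EuclideanSpace ℝ (Fin d), ‖v‖ = 1 →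
    σ ≤ variance (fun x => inner ℝ v x) μ
  subgaussian : ∀ v : EuclideanSpace ℝ (Fin d), ‖v‖ = 1 → ∀ t : ℝ, 0 < t →
    μ.real {x | t ≤ |inner ℝ v x|} ≤ 2 * Real.exp (-t ^ 2 / K ^ 2)

/-- A randomized bandit algorithm with action set the closed unit ball of `ℝ^d`, running for
`horizon` rounds `t = 0, …, horizon - 1`. The action of round `t` is a measurable function of
the external randomness (the seed) and of the rewards of the rounds before `t`; the earlier
actions are themselves functions of these. -/
structure BanditAlgorithm (d : ℕ) where
  Seed : Type
  [measurableSeed : MeasurableSpace Seed]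
  seedLaw : Measure Seed
  [isProb : IsProbabilityMeasure seedLaw]
  horizon : ℕ
  act : (t : ℕ) → Seed → (Fin t → ℝ) → EuclideanSpace ℝ (Fin d)
  norm_act_le : ∀ t s h, ‖act t s h‖ ≤ 1
  measurable_act : ∀ t, Measurable (fun p : Seed × (Fin t → ℝ) => act t p.1 p.2)

namespace BanditAlgorithm

attribute [instance] BanditAlgorithm.measurableSeed BanditAlgorithm.isProb

variable {d : ℕ}

/-- A sample point: the parameter `ℓ*`, the seed, and the reward noises `w_0, w_1, …`. -/
abbrev Env (alg : BanditAlgorithm d) : Type :=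
  EuclideanSpace ℝ (Fin d) × alg.Seed × (ℕ → ℝ)

/-- The joint law: `ℓ* ~ μ`, the seed, and i.i.d. `N(0,1)` noises, all independent. -/
def law (alg : BanditAlgorithm d) (μ : Measure (EuclideanSpace ℝ (Fin d))) :
    Measure alg.Env :=
  μ.prod (alg.seedLaw.prod (Measure.infinitePi (fun _ : ℕ => gaussianReal 0 1)))

/-- The reward `r_t = ⟨A_t, ℓ*⟩ + w_t`, where `A_t` is computed from the earlier rewards. -/
def reward (alg : BanditAlgorithm d) (ω : alg.Env) (t : ℕ) : ℝ :=
  inner ℝ (alg.act t ω.2.1 (fun i : Fin t => alg.reward ω i)) ω.1 + ω.2.2 t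
termination_by t
decreasing_by exact i.2

/-- The action `A_t` recommended in round `t`. -/
def action (alg : BanditAlgorithm d) (t : ℕ) (ω : alg.Env) : EuclideanSpace ℝ (Fin d) :=
  alg.act t ω.2.1 (fun i : Fin t => alg.reward ω i)

theorem measurable_reward (alg : BanditAlgorithm d) (t : ℕ) :
    Measurable (fun ω : alg.Env => alg.reward ω t) := by
  induction t using Nat.strong_induction_on with
  | _ t ih =>
    have h : Measurable (fun ω : alg.Env => (fun i : Fin t => alg.reward ω i)) :=
      measurable_pi_lambda _ (fun i => ih i i.2)
    have ha : Measurable (fun ω : alg.Env =>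
        alg.act t ω.2.1 (fun i : Fin t => alg.reward ω i)) :=
      (alg.measurable_act t).comp (measurable_snd.fst.prodMk h)
    have e : (fun ω : alg.Env => alg.reward ω t) = fun ω =>
        inner ℝ (alg.act t ω.2.1 (fun i : Fin t => alg.reward ω i)) ω.1 + ω.2.2 t := by
      funext ω
      rw [reward]
    rw [e]
    exact (ha.inner measurable_fst).add ((measurable_pi_apply t).comp measurable_snd.snd)

/-- Hence `σ(A_t)` is a sub-σ-algebra, and conditioning on it below is meaningful. -/
theorem measurable_action (alg : BanditAlgorithm d) (t : ℕ) : Measurable (alg.action t) :=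
  (alg.measurable_act t).comp
    (measurable_snd.fst.prodMk (measurable_pi_lambda _ (fun i => alg.measurable_reward i)))

/-- Bayesian incentive compatibility: in every round, almost surely, the recommended action
maximizes `a ↦ E[⟨ℓ*, a⟩ | A_t] = ⟨E[ℓ* | A_t], a⟩` over the unit ball. -/
def IsBIC (alg : BanditAlgorithm d) (μ : Measure (EuclideanSpace ℝ (Fin d))) : Prop :=
  ∀ t < alg.horizon, ∀ᵐ ω ∂(alg.law μ),
    IsMaxOn
      (fun a : EuclideanSpace ℝ (Fin d) =>
        inner ℝ
          (((alg.law μ)[fun ω' : alg.Env => ω'.1 |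
            MeasurableSpace.comap (alg.action t) inferInstance]) ω) a)
      (Metric.closedBall 0 1) (alg.action t ω)

/-- `lam`-spectral exploration, almost surely: `∑_t A_t A_tᵀ ⪰ lam • I`. -/
def SpectrallyExplores (alg : BanditAlgorithm d) (μ : Measure (EuclideanSpace ℝ (Fin d)))
    (lam : ℝ) : Prop :=
  ∀ᵐ ω ∂(alg.law μ),
    ((∑ t ∈ Finset.range alg.horizon,
        Matrix.vecMulVec (alg.action t ω).ofLp (alg.action t ω).ofLp) -
      lam • (1 : Matrix (Fin d) (Fin d) ℝ)).PosSemidef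

/-- The algorithm run `N` times in succession. Each run uses its own independent seed and only
the rewards observed during that run. -/
def repeatRuns (alg : BanditAlgorithm d) (N : ℕ) : BanditAlgorithm d where
  Seed := ℕ → alg.Seed
  seedLaw := Measure.infinitePi (fun _ : ℕ => alg.seedLaw)
  horizon := N * alg.horizon
  act t s h :=
    alg.act (t % alg.horizon) (s (t / alg.horizon))
      (fun i => h ⟨t / alg.horizon * alg.horizon + i, by
        have h1 := Nat.div_add_mod' t alg.horizon
        have h2 := i.2
        omega⟩)
  norm_act_le t s h := alg.norm_act_le _ _ _
  measurable_act t := by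
    refine (alg.measurable_act (t % alg.horizon)).comp (Measurable.prodMk ?_ ?_)
    · exact (measurable_pi_apply (t / alg.horizon)).comp measurable_fst
    · exact measurable_pi_lambda _ (fun i => (measurable_pi_apply _).comp measurable_snd)

end BanditAlgorithm

end

/-! A recommendation with finitely many values is BIC as soon as, for each value `x`, `‖x‖ = 1` and
the integral of the parameter over the event that `x` is recommended is a nonnegative multiple of
`x`. So for any observable event, playing the normalized integral of `ℓ*` on it and the normalized
integral over the complement off it is BIC (`exists_extends_block`). Designing the algorithm means
choosing events whose integrals point in useful directions.

The seed is a pair of uniform variables. The first coordinate fixes which seeds explore what. A set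
`D` of first coordinates is informed on a subspace `V` if some weights depending only on round and
first coordinate turn the rewards into an unbiased estimator of the projection of `ℓ*` to `V`. Such
weights are independent of the noise, so the estimation error is sub-gaussian, with no adaptivity to
control. The second coordinate only randomizes acceptance.

The engine is `exists_steering`. The vectors `∫ ψ(estimate) ℓ*` with `0 ≤ ψ ≤ 1`, projected to `V`,
form a convex set; thresholding the estimate in direction `v` bounds its support function from
below; hence the set contains a ball, and every vector in that ball is realized by an observable
event. Adjoining to that event a disjoint set of seeds that have not yet explored a direction
corrects the integral to which they contribute, so that these seeds can be sent in a new direction.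

Two phases use this. In the thinning phase (`exists_initial_exploration`), a fixed fraction `q` of
the informed seeds is added to a steered event that cancels the projection of their prior mean to
`V`. The integral becomes orthogonal to `V` and gives a new direction. After `d - 1` repetitions a
fraction `q ^ (d - 1)` of the seeds knows all directions. In the doubling phase
(`exists_full_exploration`), with `v₁` the direction of the prior mean, the prior is centered on the
complement of `v₁`, so the fully informed seeds can steer an at most equal mass of new seeds to any
`b` orthogonal to `v₁`. The recommendation then has a component along `b` bounded below
independently of the mass, and a further block of `v₁` lets the estimator remove the rest. Order `d
* log (1 / q)` doublings inform all seeds.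

An unbiased estimator with covariance at most the identity forces the sum of `A Aᵀ` to dominate the
identity, by Cauchy–Schwarz (`Informed.spectrallyExplores`). The resulting policy explores at level
`1` in order `L (d² / σ⁶ + d / c²)` rounds, where `L` is the logarithmic factor and constants depend
on `K`. Both claims follow from it by monotonicity and repetition. -/

/-- If `A` takes finitely many values, all of them unit vectors, and the integral of `f` over each
level set `{A = x}` is a nonnegative multiple of `x`, then `A` maximizes `⟨E[f | A], ·⟩` over the
unit ball. -/
theorem ae_isMaxOn_condExp_of_finite_range {Ω E : Type*} [MeasurableSpace Ω]
    [NormedAddCommGroup E] [InnerProductSpace ℝ E] [FiniteDimensional ℝ E] [MeasurableSpace E]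
    [BorelSpace E] {P : Measure Ω} [IsProbabilityMeasure P] {f A : Ω → E} (hf : Integrable f P)
    (hA : Measurable A) (F : Finset E) (hAF : ∀ ω, A ω ∈ F)
    (hF : ∀ x ∈ F, ‖x‖ = 1 ∧ ∃ R : ℝ, 0 ≤ R ∧ ∫ ω in A ⁻¹' {x}, f ω ∂P = R • x) :
    ∀ᵐ ω ∂P, IsMaxOn (fun a : E => inner ℝ ((P[f | MeasurableSpace.comap A inferInstance]) ω) a)
      (Metric.closedBall 0 1) (A ω) := by
  set g := P[f | MeasurableSpace.comap A inferInstance] with hg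
  -- Measurability with respect to `σ(A)` makes the conditional expectation constant on level sets
  -- of `A`, so its value there is the average of `f`.
  have hfac : g.FactorsThrough A := stronglyMeasurable_condExp.factorsThrough
  have key : ∀ x ∈ F, ∀ᵐ ω ∂P, A ω = x → ∃ R : ℝ, 0 ≤ R ∧ g ω = R • x := by
    intro x hx
    obtain ⟨-, R, hR, hint⟩ := hF x hx
    have hms : MeasurableSet (A ⁻¹' {x}) := hA (measurableSet_singleton x)
    by_cases h0 : P (A ⁻¹' {x}) = 0
    · have : ∀ᵐ ω ∂P, ω ∉ A ⁻¹' {x} := measure_eq_zero_iff_ae_notMem.1 h0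
      filter_upwards [this] with ω hω h
      exact (hω h).elim
    · refine ae_of_all _ fun ω hω => ⟨(P.real (A ⁻¹' {x}))⁻¹ * R, by positivity, ?_⟩
      have h1 : ∫ ω' in A ⁻¹' {x}, g ω' ∂P = ∫ ω' in A ⁻¹' {x}, f ω' ∂P :=
        setIntegral_condExp hA.comap_le hf ⟨{x}, measurableSet_singleton x, rfl⟩
      have h2 : ∫ ω' in A ⁻¹' {x}, g ω' ∂P = ∫ _ in A ⁻¹' {x}, g ω ∂P := by
        refine setIntegral_congr_fun hms fun ω' hω' => hfac ?_
        rw [hω]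
        exact hω'
      have hpos : P.real (A ⁻¹' {x}) ≠ 0 := by
        rw [Measure.real, ENNReal.toReal_ne_zero]
        exact ⟨h0, measure_ne_top _ _⟩
      rw [h1, hint, setIntegral_const] at h2
      rw [mul_smul, h2, smul_smul, inv_mul_cancel₀ hpos, one_smul]
  filter_upwards [(ae_ball_iff F.countable_toSet).2 key] with ω hω a ha
  obtain ⟨R, hR, hgω⟩ := hω (A ω) (hAF ω) rfl
  have hn := (hF _ (hAF ω)).1
  have ha' : ‖a‖ ≤ 1 := by simpa using ha
  simp only [Set.mem_ofPred_eq, hgω, real_inner_smul_left, real_inner_self_eq_norm_sq, hn]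
  have := real_inner_le_norm (A ω) a
  rw [hn] at this
  nlinarith

/-! ### Finitely valued BIC recommendations and repeated runs -/

namespace BanditAlgorithm

variable {d : ℕ}

instance (alg : BanditAlgorithm d) (μ : Measure (EuclideanSpace ℝ (Fin d)))
    [IsProbabilityMeasure μ] : IsProbabilityMeasure (alg.law μ) := by
  unfold law; infer_instance

/-- Each recommendation takes finitely many values, all of them unit vectors, and the integral of
the parameter over the event that `x` is recommended is a nonnegative multiple of `x`. -/
def IsFinitelyBIC (alg : BanditAlgorithm d) (μ : Measure (EuclideanSpace ℝ (Fin d))) : Prop :=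
  ∀ t < alg.horizon, ∃ F : Finset (EuclideanSpace ℝ (Fin d)), (∀ ω, alg.action t ω ∈ F) ∧
    ∀ x ∈ F, ‖x‖ = 1 ∧ ∃ R : ℝ, 0 ≤ R ∧
      ∫ ω in alg.action t ⁻¹' {x}, ω.1 ∂(alg.law μ) = R • x

theorem integrable_fst_law (alg : BanditAlgorithm d) {μ : Measure (EuclideanSpace ℝ (Fin d))}
    [IsProbabilityMeasure μ] (hμ : Integrable (fun x => x) μ) :
    Integrable (fun ω : alg.Env => ω.1) (alg.law μ) :=
  hμ.comp_fst _

theorem IsFinitelyBIC.isBIC {alg : BanditAlgorithm d} {μ : Measure (EuclideanSpace ℝ (Fin d))}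
    [IsProbabilityMeasure μ] (hμ : Integrable (fun x => x) μ) (h : alg.IsFinitelyBIC μ) :
    alg.IsBIC μ := by
  intro t ht
  obtain ⟨F, hAF, hF⟩ := h t ht
  exact ae_isMaxOn_condExp_of_finite_range (alg.integrable_fst_law hμ)
    (alg.measurable_action t) F hAF hF

theorem reward_eq (alg : BanditAlgorithm d) (ω : alg.Env) (t : ℕ) :
    alg.reward ω t = inner ℝ (alg.action t ω) ω.1 + ω.2.2 t := by
  rw [reward, action]

/-- The sample point seen by the `k`-th run of a repeated algorithm. -/
def runEnv (alg : BanditAlgorithm d) (N k : ℕ) (ω : (alg.repeatRuns N).Env) : alg.Env :=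
  (ω.1, (show ℕ → alg.Seed from ω.2.1) k, fun i => ω.2.2 (k * alg.horizon + i))

theorem measurePreserving_runEnv (alg : BanditAlgorithm d) (N k : ℕ)
    (μ : Measure (EuclideanSpace ℝ (Fin d))) [IsProbabilityMeasure μ] :
    MeasurePreserving (alg.runEnv N k) ((alg.repeatRuns N).law μ) (alg.law μ) := by
  have h1 : MeasurePreserving (fun s : ℕ → alg.Seed => s k)
      (Measure.infinitePi (fun _ : ℕ => alg.seedLaw)) alg.seedLaw :=
    measurePreserving_eval_infinitePi (fun _ : ℕ => alg.seedLaw) k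
  have h2 : MeasurePreserving (fun (w : ℕ → ℝ) (i : ℕ) => w (k * alg.horizon + i))
      (Measure.infinitePi (fun _ : ℕ => gaussianReal 0 1))
      (Measure.infinitePi (fun _ : ℕ => gaussianReal 0 1)) := by
    refine ⟨by fun_prop, ?_⟩
    exact Measure.map_infinitePi_infinitePi_of_inj (P := fun _ : ℕ => gaussianReal 0 1)
      (add_right_injective (k * alg.horizon))
  exact (MeasurePreserving.id μ).prod (h1.prod h2)

/-- Strong induction on the round within the run: the actions of a run see only the rewards of that
run, which agree by induction. -/
theorem reward_repeatRuns (alg : BanditAlgorithm d) (N k : ℕ) (ω : (alg.repeatRuns N).Env) (i : ℕ)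
    (hi : i < alg.horizon) :
    (alg.repeatRuns N).reward ω (k * alg.horizon + i) = alg.reward (alg.runEnv N k ω) i ∧
    (alg.repeatRuns N).action (k * alg.horizon + i) ω = alg.action i (alg.runEnv N k ω) := by
  induction i using Nat.strong_induction_on with
  | _ i ih =>
    have hpos : 0 < alg.horizon := by omega
    have e1 : (k * alg.horizon + i) % alg.horizon = i := by
      rw [Nat.mul_comm, Nat.mul_add_mod, Nat.mod_eq_of_lt hi]
    have e2 : (k * alg.horizon + i) / alg.horizon = k := by
      rw [Nat.mul_comm, Nat.mul_add_div hpos, Nat.div_eq_of_lt hi, add_zero]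
    have hact : (alg.repeatRuns N).action (k * alg.horizon + i) ω =
        alg.action i (alg.runEnv N k ω) := by
      -- The type of the history depends on the round, so round and run index are generalized before
      -- the two division identities are substituted.
      have gen : ∀ (j k' : ℕ) (hj : j = i) (hk : k' = k)
          (g : Fin j → ℝ) (_ : ∀ m : Fin j, g m = alg.reward (alg.runEnv N k ω) m),
          alg.act j ((show ℕ → alg.Seed from ω.2.1) k') g =
            alg.action i (alg.runEnv N k ω) := by
        rintro j k' rfl rfl g hg
        rw [funext hg]
        rfl
      refine gen _ _ e1 e2 _ fun m => ?_
      have hm : (m : ℕ) < i := by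
        have := m.2
        omega
      rw [← (ih m hm (by omega)).1]
      simp only [e2]
    refine ⟨?_, hact⟩
    rw [reward_eq, reward_eq, hact]
    rfl

/-- Each action of the repeated algorithm is an action of the original one after a
measure-preserving map that keeps the parameter, so the level-set integrals are unchanged. -/
theorem IsFinitelyBIC.repeatRuns {alg : BanditAlgorithm d}
    {μ : Measure (EuclideanSpace ℝ (Fin d))} [IsProbabilityMeasure μ]
    (h : alg.IsFinitelyBIC μ) (N : ℕ) :
    (alg.repeatRuns N).IsFinitelyBIC μ := by
  intro t ht
  have hpos : 0 < alg.horizon := by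
    rcases Nat.eq_zero_or_pos alg.horizon with h0 | h0
    · have : t < N * alg.horizon := ht
      simp [h0] at this
    · exact h0
  have hlt := Nat.mod_lt t hpos
  have hact : (alg.repeatRuns N).action t =
      alg.action (t % alg.horizon) ∘ alg.runEnv N (t / alg.horizon) := by
    funext ω
    have := (alg.reward_repeatRuns N (t / alg.horizon) ω (t % alg.horizon) hlt).2
    rwa [Nat.div_add_mod'] at this
  obtain ⟨F, hAF, hF⟩ := h _ hlt
  refine ⟨F, fun ω => by rw [hact]; exact hAF _, fun x hx => ⟨(hF x hx).1, ?_⟩⟩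
  obtain ⟨R, hR, hint⟩ := (hF x hx).2
  refine ⟨R, hR, ?_⟩
  rw [← hint, hact]
  have hmp := alg.measurePreserving_runEnv N (t / alg.horizon) μ
  have hms : MeasurableSet (alg.action (t % alg.horizon) ⁻¹' {x}) :=
    alg.measurable_action _ (measurableSet_singleton x)
  conv_rhs => rw [← hmp.map_eq]
  rw [setIntegral_map hms measurable_fst.aestronglyMeasurable hmp.measurable.aemeasurable]
  rfl

theorem SpectrallyExplores.repeatRuns {alg : BanditAlgorithm d}
    {μ : Measure (EuclideanSpace ℝ (Fin d))} [IsProbabilityMeasure μ] {lam : ℝ}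
    (h : alg.SpectrallyExplores μ lam) {N : ℕ} {lamBar : ℝ} (hN : lamBar ≤ N * lam) :
    (alg.repeatRuns N).SpectrallyExplores μ lamBar := by
  have hall : ∀ᵐ ω ∂((alg.repeatRuns N).law μ), ∀ k : ℕ,
      ((∑ t ∈ Finset.range alg.horizon,
        Matrix.vecMulVec (alg.action t (alg.runEnv N k ω)).ofLp
          (alg.action t (alg.runEnv N k ω)).ofLp) -
      lam • (1 : Matrix (Fin d) (Fin d) ℝ)).PosSemidef :=
    ae_all_iff.2 fun k => (alg.measurePreserving_runEnv N k μ).quasiMeasurePreserving.ae h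
  filter_upwards [hall] with ω hω
  have hsum : ∑ t ∈ Finset.range (alg.repeatRuns N).horizon,
      Matrix.vecMulVec ((alg.repeatRuns N).action t ω).ofLp
        ((alg.repeatRuns N).action t ω).ofLp =
      ∑ k ∈ Finset.range N, ∑ t ∈ Finset.range alg.horizon,
        Matrix.vecMulVec (alg.action t (alg.runEnv N k ω)).ofLp
          (alg.action t (alg.runEnv N k ω)).ofLp := by
    change ∑ t ∈ Finset.range (N * alg.horizon), _ = _
    have gen : ∀ n : ℕ, ∑ t ∈ Finset.range (n * alg.horizon),
      Matrix.vecMulVec ((alg.repeatRuns N).action t ω).ofLp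
        ((alg.repeatRuns N).action t ω).ofLp =
      ∑ k ∈ Finset.range n, ∑ t ∈ Finset.range alg.horizon,
        Matrix.vecMulVec (alg.action t (alg.runEnv N k ω)).ofLp
          (alg.action t (alg.runEnv N k ω)).ofLp := by
      intro n
      induction n with
      | zero => simp
      | succ n ih =>
        rw [Nat.succ_mul, Finset.sum_range_add, ih, Finset.sum_range_succ]
        congr 1
        refine Finset.sum_congr rfl fun t ht => ?_
        rw [(alg.reward_repeatRuns N n ω t (Finset.mem_range.1 ht)).2]
    exact gen N
  rw [hsum]
  -- Each run contributes a positive semidefinite excess over `lam • 1`; what remains is the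
  -- nonnegative multiple `N * lam - lamBar` of the identity.
  have hdecomp : (∑ k ∈ Finset.range N, ∑ t ∈ Finset.range alg.horizon,
        Matrix.vecMulVec (alg.action t (alg.runEnv N k ω)).ofLp
          (alg.action t (alg.runEnv N k ω)).ofLp) - lamBar • (1 : Matrix (Fin d) (Fin d) ℝ) =
      (∑ k ∈ Finset.range N, ((∑ t ∈ Finset.range alg.horizon,
        Matrix.vecMulVec (alg.action t (alg.runEnv N k ω)).ofLp
          (alg.action t (alg.runEnv N k ω)).ofLp) - lam • (1 : Matrix (Fin d) (Fin d) ℝ))) +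
      (N * lam - lamBar) • (1 : Matrix (Fin d) (Fin d) ℝ) := by
    rw [Finset.sum_sub_distrib, Finset.sum_const, Finset.card_range, sub_smul, mul_smul,
      Nat.cast_smul_eq_nsmul]
    abel
  rw [hdecomp]
  exact (Matrix.posSemidef_sum _ fun k _ => hω k).add
    (Matrix.PosSemidef.one.smul (sub_nonneg.2 hN))

theorem SpectrallyExplores.mono {alg : BanditAlgorithm d}
    {μ : Measure (EuclideanSpace ℝ (Fin d))} {lam lam' : ℝ}
    (h : alg.SpectrallyExplores μ lam) (hle : lam' ≤ lam) : alg.SpectrallyExplores μ lam' := by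
  filter_upwards [h] with ω hω
  have := hω.add (Matrix.PosSemidef.one (n := Fin d) (R := ℝ) |>.smul (sub_nonneg.2 hle))
  convert this using 1
  rw [sub_smul]
  abel

end BanditAlgorithm

/-! ### Moments of sub-gaussian priors -/

/-- `μ` is a law on `ℝ^d` all of whose one-dimensional marginals have first, second and fourth
absolute moments at most `B`. -/
structure MomentBound {d : ℕ} (μ : Measure (EuclideanSpace ℝ (Fin d))) (B : ℝ) : Prop where
  one_le : 1 ≤ B
  integrable : Integrable (fun x => x) μ
  integrable_four : ∀ v : EuclideanSpace ℝ (Fin d), ‖v‖ = 1 →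
    Integrable (fun x => (inner ℝ v x : ℝ) ^ 4) μ
  integrable_two : ∀ v : EuclideanSpace ℝ (Fin d), ‖v‖ = 1 →
    Integrable (fun x => (inner ℝ v x : ℝ) ^ 2) μ
  abs_le : ∀ v : EuclideanSpace ℝ (Fin d), ‖v‖ = 1 → ∫ x, |inner ℝ v x| ∂μ ≤ B
  two_le : ∀ v : EuclideanSpace ℝ (Fin d), ‖v‖ = 1 → ∫ x, (inner ℝ v x : ℝ) ^ 2 ∂μ ≤ B
  four_le : ∀ v : EuclideanSpace ℝ (Fin d), ‖v‖ = 1 → ∫ x, (inner ℝ v x : ℝ) ^ 4 ∂μ ≤ B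

/-- Layer-cake formula for the fourth moment. The resulting bound depends on `K` alone, not on `d`,
`μ` or `v`. -/
theorem lintegral_pow_four_le_of_subgaussian {d : ℕ} {μ : Measure (EuclideanSpace ℝ (Fin d))}
    [IsProbabilityMeasure μ] {K : ℝ} (v : EuclideanSpace ℝ (Fin d))
    (h : ∀ t : ℝ, 0 < t → μ.real {x | t ≤ |inner ℝ v x|} ≤ 2 * Real.exp (-t ^ 2 / K ^ 2)) :
    ∫⁻ x, ENNReal.ofReal ((inner ℝ v x : ℝ) ^ 4) ∂μ ≤
      ENNReal.ofReal 4 * ∫⁻ t in Set.Ioi (0 : ℝ),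
        ENNReal.ofReal (2 * Real.exp (-t ^ 2 / K ^ 2)) * ENNReal.ofReal (t ^ ((4 : ℝ) - 1)) := by
  have h4 : ∀ x : EuclideanSpace ℝ (Fin d),
      (inner ℝ v x : ℝ) ^ 4 = |inner ℝ v x| ^ (4 : ℝ) := by
    intro x
    rw [show (4 : ℝ) = ((4 : ℕ) : ℝ) by norm_num, Real.rpow_natCast,
      Even.pow_abs (by decide)]
  simp_rw [h4]
  rw [lintegral_rpow_eq_lintegral_meas_le_mul μ
    (f := fun x : EuclideanSpace ℝ (Fin d) => |(inner ℝ v x : ℝ)|)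
    (ae_of_all _ fun x => abs_nonneg _) (by fun_prop) (by norm_num : (0 : ℝ) < 4)]
  refine mul_le_mul_right ?_ _
  refine setLIntegral_mono' (measurableSet_Ioi (a := (0 : ℝ))) fun t ht => ?_
  gcongr
  rw [← ofReal_measureReal]
  exact ENNReal.ofReal_le_ofReal (h t ht)

theorem lintegral_pow_mul_exp_ne_top {K : ℝ} (hK : 0 < K) :
    ENNReal.ofReal 4 * ∫⁻ t in Set.Ioi (0 : ℝ),
      ENNReal.ofReal (2 * Real.exp (-t ^ 2 / K ^ 2)) * ENNReal.ofReal (t ^ ((4 : ℝ) - 1)) ≠ ⊤ := by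
  refine ENNReal.mul_ne_top ENNReal.ofReal_ne_top ?_
  have hint := (integrable_rpow_mul_exp_neg_mul_sq (b := 1 / K ^ 2) (s := (4 : ℝ) - 1)
    (by positivity) (by norm_num)).const_mul 2
  have e : ∀ t : ℝ, ENNReal.ofReal (2 * Real.exp (-t ^ 2 / K ^ 2)) *
      ENNReal.ofReal (t ^ ((4 : ℝ) - 1)) =
      ENNReal.ofReal (2 * (t ^ ((4 : ℝ) - 1) * Real.exp (-(1 / K ^ 2) * t ^ 2))) := by
    intro t
    rw [← ENNReal.ofReal_mul (by positivity)]
    congr 1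
    rw [show -t ^ 2 / K ^ 2 = -(1 / K ^ 2) * t ^ 2 by ring]
    ring
  simp_rw [e]
  exact (hint.integrableOn (s := Set.Ioi 0)).lintegral_lt_top.ne

/-- Sub-gaussian priors have uniformly bounded moments, in terms of the sub-gaussian constant. -/
theorem exists_momentBound (K : ℝ) (hK : 0 < K) : ∃ B : ℝ, ∀ (d : ℕ)
    (μ : Measure (EuclideanSpace ℝ (Fin d))) [IsProbabilityMeasure μ] (c ε σ : ℝ),
    PriorAssumption μ c ε σ K → MomentBound μ B := by
  set B0 := (ENNReal.ofReal 4 * ∫⁻ t in Set.Ioi (0 : ℝ),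
      ENNReal.ofReal (2 * Real.exp (-t ^ 2 / K ^ 2)) * ENNReal.ofReal (t ^ ((4 : ℝ) - 1))).toReal
  have hB0 : 0 ≤ B0 := ENNReal.toReal_nonneg
  -- The added `1` covers the first and second moments through `|y| ≤ 1 + y ^ 4` and `y ^ 2 ≤ 1 + y
  -- ^ 4`.
  refine ⟨1 + B0, fun d μ _ c ε σ h => ?_⟩
  have hlin : ∀ v : EuclideanSpace ℝ (Fin d), ‖v‖ = 1 →
      ∫⁻ x, ENNReal.ofReal ((inner ℝ v x : ℝ) ^ 4) ∂μ ≤ ENNReal.ofReal B0 := fun v hv => by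
    rw [ENNReal.ofReal_toReal (lintegral_pow_mul_exp_ne_top hK)]
    exact lintegral_pow_four_le_of_subgaussian v (h.subgaussian v hv)
  have h4 : ∀ v : EuclideanSpace ℝ (Fin d), ‖v‖ = 1 →
      Integrable (fun x => (inner ℝ v x : ℝ) ^ 4) μ := fun v hv =>
    (lintegral_ofReal_ne_top_iff_integrable (by fun_prop)
      (ae_of_all _ fun x => by positivity)).1
      ((hlin v hv).trans_lt ENNReal.ofReal_lt_top).ne
  have h4le : ∀ v : EuclideanSpace ℝ (Fin d), ‖v‖ = 1 →
      ∫ x, (inner ℝ v x : ℝ) ^ 4 ∂μ ≤ B0 := fun v hv => by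
    rw [integral_eq_lintegral_of_nonneg_ae (ae_of_all _ fun x => by positivity) (by fun_prop)]
    exact ENNReal.toReal_le_of_le_ofReal hB0 (hlin v hv)
  have hdom : ∀ v : EuclideanSpace ℝ (Fin d), ‖v‖ = 1 →
      Integrable (fun x => 1 + (inner ℝ v x : ℝ) ^ 4) μ := fun v hv =>
    (integrable_const 1).add (h4 v hv)
  have habs : ∀ y : ℝ, |y| ≤ 1 + y ^ 4 := fun y => by
    rcases abs_cases y with ⟨h, _⟩ | ⟨h, _⟩ <;> rw [h] <;>
      nlinarith [sq_nonneg (y ^ 2 - 1), sq_nonneg (y - 1), sq_nonneg (y + 1), sq_nonneg (y ^ 2)]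
  have hsq : ∀ y : ℝ, y ^ 2 ≤ 1 + y ^ 4 := fun y => by nlinarith [sq_nonneg (y ^ 2 - 1)]
  have h2 : ∀ v : EuclideanSpace ℝ (Fin d), ‖v‖ = 1 →
      Integrable (fun x => (inner ℝ v x : ℝ) ^ 2) μ := fun v hv =>
    (hdom v hv).mono' (by fun_prop) (ae_of_all _ fun x => by
      rw [Real.norm_eq_abs, abs_of_nonneg (sq_nonneg _)]
      exact hsq _)
  have h1 : ∀ v : EuclideanSpace ℝ (Fin d), ‖v‖ = 1 →
      Integrable (fun x => (inner ℝ v x : ℝ)) μ := fun v hv =>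
    (hdom v hv).mono' (by fun_prop) (ae_of_all _ fun x => habs _)
  have hval : ∀ v : EuclideanSpace ℝ (Fin d), ‖v‖ = 1 →
      ∫ x, (1 + (inner ℝ v x : ℝ) ^ 4) ∂μ ≤ 1 + B0 := fun v hv => by
    rw [integral_add (integrable_const 1) (h4 v hv)]
    simpa using h4le v hv
  refine ⟨by linarith, ?_, h4, h2, ?_, ?_, ?_⟩
  · have hc : ∀ i, Integrable (fun x : EuclideanSpace ℝ (Fin d) => x i) μ := fun i => by
      have := h1 (EuclideanSpace.single i (1 : ℝ)) (by simp)
      simpa [EuclideanSpace.inner_single_left] using this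
    have hs : Integrable (fun x : EuclideanSpace ℝ (Fin d) =>
        ∑ i, x i • EuclideanSpace.single i (1 : ℝ)) μ :=
      integrable_finsetSum _ fun i _ => (hc i).smul_const _
    refine hs.congr (ae_of_all _ fun x => ?_)
    ext j
    simp [Pi.single_apply]
  · exact fun v hv => (integral_mono_of_nonneg (ae_of_all _ fun x => abs_nonneg _) (hdom v hv)
      (ae_of_all _ fun x => habs _)).trans (hval v hv)
  · exact fun v hv => (integral_mono (h2 v hv) (hdom v hv) fun x => hsq _).trans (hval v hv)
  · exact fun v hv => (h4le v hv).trans (by linarith)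

namespace MomentBound

variable {d : ℕ} {μ : Measure (EuclideanSpace ℝ (Fin d))} {B : ℝ}

theorem pos (h : MomentBound μ B) : 0 < B := by linarith [h.one_le]

theorem integrable_inner (h : MomentBound μ B) (v : EuclideanSpace ℝ (Fin d)) :
    Integrable (fun x => (inner ℝ v x : ℝ)) μ :=
  h.integrable.const_inner v

theorem inner_mean (h : MomentBound μ B) (v : EuclideanSpace ℝ (Fin d)) :
    inner ℝ v (∫ x, x ∂μ) = ∫ x, (inner ℝ v x : ℝ) ∂μ :=
  (integral_inner h.integrable v).symm

theorem norm_mean_le (h : MomentBound μ B) : ‖∫ x, x ∂μ‖ ≤ B := by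
  set m := ∫ x, x ∂μ
  rcases eq_or_ne m 0 with h0 | h0
  · rw [h0, norm_zero]; exact h.pos.le
  · have hv : ‖(‖m‖⁻¹ • m)‖ = 1 := norm_smul_inv_norm h0
    have h1 : inner ℝ (‖m‖⁻¹ • m) m = ‖m‖ := by
      rw [real_inner_smul_left, real_inner_self_eq_norm_sq]
      field_simp
    rw [← h1, h.inner_mean]
    exact (integral_mono (h.integrable_inner _) (h.integrable_inner _).abs
      fun x => le_abs_self _).trans (h.abs_le _ hv)

/-- A centered marginal with variance at least `σ` has a quantitatively positive part. -/
theorem integral_pos_part_ge [IsProbabilityMeasure μ] (h : MomentBound μ B) {σ : ℝ} (hσ : 0 < σ)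
    {v : EuclideanSpace ℝ (Fin d)} (hv : ‖v‖ = 1)
    (hvar : σ ≤ variance (fun x => inner ℝ v x) μ) (hmean : ∫ x, (inner ℝ v x : ℝ) ∂μ = 0) :
    σ * √σ / (8 * B) ≤ ∫ x, max (inner ℝ v x : ℝ) 0 ∂μ := by
  have hB := h.pos
  have hi := h.integrable_inner v
  have hs : 0 < √σ := Real.sqrt_pos.2 hσ
  have hss : √σ * √σ = σ := Real.mul_self_sqrt hσ.le
  have h2 : σ ≤ ∫ x, (inner ℝ v x : ℝ) ^ 2 ∂μ := by
    refine hvar.trans ?_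
    rw [variance_eq_integral hi.aemeasurable, hmean]
    simp
  -- Truncation level: `y ^ 2 ≤ M |y| + y ^ 4 / M ^ 2`, and this `M` makes the quartic term at most
  -- `σ / 4`, so the variance forces a lower bound on the first absolute moment.
  set M := 2 * B / √σ with hM
  have hMpos : 0 < M := by positivity
  have hpt : ∀ y : ℝ, y ^ 2 ≤ M * |y| + (M ^ 2)⁻¹ * y ^ 4 := by
    intro y
    rw [← sq_abs y, show y ^ 4 = |y| ^ 4 from (Even.pow_abs (by decide) y).symm]
    have hy := abs_nonneg y
    rcases le_total |y| M with hle | hle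
    · have : |y| ^ 2 ≤ M * |y| := by nlinarith
      have : 0 ≤ (M ^ 2)⁻¹ * |y| ^ 4 := by positivity
      linarith
    · have h1 : M ^ 2 ≤ |y| ^ 2 := by gcongr
      have h2 : |y| ^ 2 ≤ (M ^ 2)⁻¹ * |y| ^ 4 := by
        rw [inv_mul_eq_div, le_div_iff₀ (by positivity)]
        nlinarith [sq_nonneg |y|]
      have : 0 ≤ M * |y| := by positivity
      linarith
  have hI : ∫ x, (inner ℝ v x : ℝ) ^ 2 ∂μ ≤
      M * ∫ x, |inner ℝ v x| ∂μ + (M ^ 2)⁻¹ * ∫ x, (inner ℝ v x : ℝ) ^ 4 ∂μ := by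
    rw [← integral_const_mul, ← integral_const_mul,
      ← integral_add (hi.abs.const_mul _) ((h.integrable_four v hv).const_mul _)]
    exact integral_mono (h.integrable_two v hv)
      ((hi.abs.const_mul _).add ((h.integrable_four v hv).const_mul _)) fun x => hpt _
  have hM4 : (M ^ 2)⁻¹ * ∫ x, (inner ℝ v x : ℝ) ^ 4 ∂μ ≤ σ / 4 := by
    have h1 : (M ^ 2)⁻¹ = σ / (4 * B ^ 2) := by
      rw [hM, div_pow, inv_div, Real.sq_sqrt hσ.le]
      ring
    rw [h1]
    calc σ / (4 * B ^ 2) * ∫ x, (inner ℝ v x : ℝ) ^ 4 ∂μ ≤ σ / (4 * B ^ 2) * B :=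
          mul_le_mul_of_nonneg_left (h.four_le v hv) (by positivity)
      _ = σ / 4 / B := by field_simp
      _ ≤ σ / 4 := div_le_self (by positivity) h.one_le
  have habs : σ * √σ / (4 * B) ≤ ∫ x, |inner ℝ v x| ∂μ := by
    have : σ / 2 ≤ M * ∫ x, |inner ℝ v x| ∂μ := by linarith
    rw [hM, div_mul_eq_mul_div, le_div_iff₀ hs] at this
    rw [div_le_iff₀ (by positivity)]
    linarith
  -- For a centered variable the positive part carries half of the absolute moment.
  have hmax : ∫ x, max (inner ℝ v x : ℝ) 0 ∂μ = (∫ x, |inner ℝ v x| ∂μ) / 2 := by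
    have e : ∀ x : EuclideanSpace ℝ (Fin d), max (inner ℝ v x : ℝ) 0 =
        (|inner ℝ v x| + inner ℝ v x) / 2 := fun x => by
      rcases le_total 0 (inner ℝ v x : ℝ) with h | h
      · rw [max_eq_left h, abs_of_nonneg h]; ring
      · rw [max_eq_right h, abs_of_nonpos h]; ring
    simp_rw [e]
    rw [integral_div, integral_add hi.abs hi, hmean, add_zero]
  rw [hmax]
  calc σ * √σ / (8 * B) = σ * √σ / (4 * B) / 2 := by field_simp; norm_num
    _ ≤ _ := by linarith

end MomentBound

/-! ### Deterministic linear combinations of the noise -/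

/-- The law of the sequence of reward noises. -/
noncomputable abbrev noiseLaw : Measure (ℕ → ℝ) := Measure.infinitePi (fun _ : ℕ => gaussianReal 0 1)

theorem hasSubgaussianMGF_noise_sum (b : ℕ → ℝ) (T : ℕ) {τ : NNReal}
    (h : ∑ t ∈ Finset.range T, b t ^ 2 ≤ τ) :
    HasSubgaussianMGF (fun w : ℕ → ℝ => ∑ t ∈ Finset.range T, w t * b t) τ noiseLaw := by
  have hid : HasSubgaussianMGF id 1 (gaussianReal 0 1) :=
    ⟨fun t => by simpa using integrable_exp_mul_gaussianReal t, fun t => by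
      rw [mgf_id_gaussianReal]; simp⟩
  have hw : ∀ t : ℕ, HasSubgaussianMGF (fun w : ℕ → ℝ => w t) 1 noiseLaw := fun t => by
    refine (HasSubgaussianMGF.id_map_iff (measurable_pi_apply t).aemeasurable).1 ?_
    have := Measure.infinitePi_map_eval (fun _ : ℕ => gaussianReal 0 1) t
    rw [this]
    exact hid
  have hind : iIndepFun (fun (t : ℕ) (w : ℕ → ℝ) => b t * w t) noiseLaw :=
    iIndepFun_infinitePi (X := fun t x => b t * x) (by fun_prop)
  have hsum := HasSubgaussianMGF.sum_of_iIndepFun hind (s := Finset.range T)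
    (c := fun t => ⟨b t ^ 2, sq_nonneg _⟩ * 1) fun t _ => (hw t).const_mul (b t)
  simp_rw [mul_comm (_ : ℝ) (b _)]
  refine ⟨hsum.integrable_exp_mul, fun t => (hsum.mgf_le t).trans ?_⟩
  gcongr
  rw [← NNReal.coe_le_coe, NNReal.coe_sum]
  refine le_of_eq_of_le (Finset.sum_congr rfl fun i _ => ?_) h
  exact mul_one _

theorem noise_tail_le (b : ℕ → ℝ) (T : ℕ) {τ : ℝ}
    (h : ∑ t ∈ Finset.range T, b t ^ 2 ≤ τ) {x : ℝ} (hx : 0 ≤ x) :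
    noiseLaw {w | x ≤ |∑ t ∈ Finset.range T, w t * b t|} ≤
      ENNReal.ofReal (2 * Real.exp (-x ^ 2 / (2 * τ))) := by
  have hτ : 0 ≤ τ := le_trans (Finset.sum_nonneg fun t _ => sq_nonneg _) h
  lift τ to NNReal using hτ
  have hsub := hasSubgaussianMGF_noise_sum b T h
  rw [← ofReal_measureReal]
  refine ENNReal.ofReal_le_ofReal ?_
  have h1 := hsub.measure_ge_le hx
  have h2 := hsub.neg.measure_ge_le hx
  have hset : {w : ℕ → ℝ | x ≤ |∑ t ∈ Finset.range T, w t * b t|} =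
      {w | x ≤ ∑ t ∈ Finset.range T, w t * b t} ∪
        {w | x ≤ (-(fun w : ℕ → ℝ => ∑ t ∈ Finset.range T, w t * b t)) w} := by
    ext w
    simp [le_abs]
  rw [hset]
  exact (measureReal_union_le _ _).trans (by linarith)

/-- Uses `|y| ≤ √τ * cosh (y / √τ)`; the two exponential moments at `±1 / √τ` are at most `exp (1 /
2) ≤ 2`. -/
theorem lintegral_abs_noise_le (b : ℕ → ℝ) (T : ℕ) {τ : ℝ} (hτ : 0 < τ)
    (h : ∑ t ∈ Finset.range T, b t ^ 2 ≤ τ) :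
    ∫⁻ w, ENNReal.ofReal |∑ t ∈ Finset.range T, w t * b t| ∂noiseLaw ≤
      ENNReal.ofReal (2 * √τ) := by
  lift τ to NNReal using hτ.le
  have hsub := hasSubgaussianMGF_noise_sum b T h
  set ξ := fun w : ℕ → ℝ => ∑ t ∈ Finset.range T, w t * b t with hξ
  have hs : 0 < √(τ : ℝ) := Real.sqrt_pos.2 hτ
  have hss : √(τ : ℝ) ^ 2 = τ := Real.sq_sqrt hτ.le
  set a := (√(τ : ℝ))⁻¹ with ha
  have hE : ∀ t : ℝ, t ^ 2 = a ^ 2 → ∫ w, Real.exp (t * ξ w) ∂noiseLaw ≤ 2 := fun t ht => by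
    refine (hsub.mgf_le t).trans ?_
    rw [ht, ha, inv_pow, hss, mul_inv_cancel₀ hτ.ne']
    have := Real.exp_one_lt_d9
    have h2 : Real.exp (1 / 2) ^ 2 = Real.exp 1 := by
      rw [← Real.exp_nat_mul]; norm_num
    have := Real.exp_pos (1 / 2)
    nlinarith
  have hpt : ∀ y : ℝ, |y| ≤ √(τ : ℝ) * ((Real.exp (a * y) + Real.exp (-a * y)) / 2) := by
    intro y
    have h1 : |y| = √(τ : ℝ) * |a * y| := by
      rw [abs_mul, abs_of_pos (show 0 < a by positivity), ← mul_assoc, ha,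
        mul_inv_cancel₀ hs.ne', one_mul]
    rw [h1]
    gcongr
    rw [neg_mul, ← Real.cosh_eq, ← Real.cosh_abs]
    have h0 := abs_nonneg (a * y)
    exact (Real.self_le_sinh_iff.2 h0).trans (Real.sinh_lt_cosh _).le
  have hint1 := hsub.integrable_exp_mul a
  have hint2 := hsub.integrable_exp_mul (-a)
  have hint : Integrable (fun w => √(τ : ℝ) * ((Real.exp (a * ξ w) + Real.exp (-a * ξ w)) / 2))
      noiseLaw := ((hint1.add hint2).div_const 2).const_mul _
  refine (lintegral_mono fun w => ENNReal.ofReal_le_ofReal (hpt (ξ w))).trans ?_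
  rw [← ofReal_integral_eq_lintegral_ofReal hint (ae_of_all _ fun w => by positivity)]
  refine ENNReal.ofReal_le_ofReal ?_
  rw [integral_const_mul, integral_div, integral_add hint1 hint2]
  have := hE a rfl
  have := hE (-a) (neg_sq a)
  nlinarith

/-- A convex set in a finite-dimensional space that reaches height `r` in every direction contains
the open ball of radius `r`. -/
theorem ball_subset_of_convex_of_support {F : Type*} [NormedAddCommGroup F]
    [InnerProductSpace ℝ F] [FiniteDimensional ℝ F] {s : Set F} (hs : Convex ℝ s) {r : ℝ}
    (hr : 0 < r) (hne : s.Nonempty) (h : ∀ v : F, ‖v‖ = 1 → ∃ x ∈ s, r ≤ inner ℝ v x) :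
    Metric.ball 0 r ⊆ s := by
  -- Hahn–Banach needs a closed set, so the ball is first placed in the closure: a functional
  -- separating a point of the ball would contradict the height in its own direction.
  have hcl : Metric.ball 0 r ⊆ closure s := by
    intro u hu
    by_contra hnot
    obtain ⟨f, c, hfs, hfu⟩ := geometric_hahn_banach_closed_point hs.closure isClosed_closure hnot
    obtain ⟨y, rfl⟩ := (InnerProductSpace.toDual ℝ F).surjective f
    simp only [InnerProductSpace.toDual_apply_apply] at hfs hfu
    have hy : y ≠ 0 := by
      rintro rfl
      obtain ⟨x, hx⟩ := hne
      have := hfs x (subset_closure hx)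
      simp only [inner_zero_left] at this hfu
      linarith
    have hyn : 0 < ‖y‖ := norm_pos_iff.2 hy
    obtain ⟨x, hx, hxr⟩ := h (‖y‖⁻¹ • y) (norm_smul_inv_norm hy)
    have h1 := hfs x (subset_closure hx)
    rw [real_inner_smul_left, inv_mul_eq_div, le_div_iff₀ hyn] at hxr
    have h2 := real_inner_le_norm y u
    have h3 : ‖u‖ < r := by simpa using hu
    nlinarith
  have hint : (interior (closure s)).Nonempty :=
    ⟨0, interior_maximal hcl Metric.isOpen_ball (Metric.mem_ball_self hr)⟩
  -- Removing the closure: in finite dimension a full affine span gives `s` interior, and then a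
  -- convex set and its closure have the same interior.
  have hspan : affineSpan ℝ s = ⊤ := by
    have h1 := (hs.closure.interior_nonempty_iff_affineSpan_eq_top).1 hint
    rw [eq_top_iff, ← h1, affineSpan_le]
    exact closure_minimal (subset_affineSpan ℝ s)
      (AffineSubspace.closed_of_finiteDimensional (affineSpan ℝ s))
  have hint' := (hs.interior_nonempty_iff_affineSpan_eq_top).2 hspan
  calc Metric.ball 0 r ⊆ interior (closure s) := interior_maximal hcl Metric.isOpen_ball
    _ = interior s := hs.interior_closure_eq_interior_of_nonempty_interior hint'
    _ ⊆ s := interior_subset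

/-! ### Policies and their extension by a block of rounds -/

/-- A bandit algorithm whose seed is a pair of independent uniform variables. -/
structure Policy (d : ℕ) where
  horizon : ℕ
  act : (t : ℕ) → unitInterval × unitInterval → (Fin t → ℝ) → EuclideanSpace ℝ (Fin d)
  norm_act_le : ∀ t s h, ‖act t s h‖ ≤ 1
  measurable_act : ∀ t,
    Measurable (fun q : (unitInterval × unitInterval) × (Fin t → ℝ) => act t q.1 q.2)

/-- A sample point: parameter, seed and noises. -/
abbrev Sample (d : ℕ) : Type :=
  EuclideanSpace ℝ (Fin d) × (unitInterval × unitInterval) × (ℕ → ℝ)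

/-- The law of a sample point. -/
noncomputable abbrev sampleLaw {d : ℕ} (μ : Measure (EuclideanSpace ℝ (Fin d))) :
    Measure (Sample d) :=
  μ.prod (((volume : Measure unitInterval).prod (volume : Measure unitInterval)).prod noiseLaw)

namespace Policy

variable {d : ℕ}

/-- The bandit algorithm of a policy. -/
noncomputable abbrev toAlg (p : Policy d) : BanditAlgorithm d where
  Seed := unitInterval × unitInterval
  seedLaw := (volume : Measure unitInterval).prod (volume : Measure unitInterval)
  horizon := p.horizon
  act := p.act
  norm_act_le := p.norm_act_le
  measurable_act := p.measurable_act

/-- The action of round `t`. -/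
noncomputable def action (p : Policy d) (t : ℕ) (ω : Sample d) : EuclideanSpace ℝ (Fin d) :=
  p.toAlg.action t ω

/-- The rewards of the first `T` rounds. -/
noncomputable def hist (p : Policy d) (T : ℕ) (ω : Sample d) : Fin T → ℝ :=
  fun i => p.toAlg.reward ω i

theorem action_eq (p : Policy d) (t : ℕ) (ω : Sample d) :
    p.action t ω = p.act t ω.2.1 (p.hist t ω) := rfl

theorem hist_apply (p : Policy d) (T : ℕ) (ω : Sample d) (i : Fin T) :
    p.hist T ω i = inner ℝ (p.action i ω) ω.1 + ω.2.2 i :=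
  p.toAlg.reward_eq ω i

theorem measurable_hist (p : Policy d) (T : ℕ) : Measurable (p.hist T) :=
  measurable_pi_lambda _ fun i => p.toAlg.measurable_reward i

/-- The event that seed and history at the horizon belong to `G`. -/
def event (p : Policy d) (G : Set ((unitInterval × unitInterval) × (Fin p.horizon → ℝ))) :
    Set (Sample d) :=
  {ω | (ω.2.1, p.hist p.horizon ω) ∈ G}

theorem measurableSet_event (p : Policy d)
    {G : Set ((unitInterval × unitInterval) × (Fin p.horizon → ℝ))} (hG : MeasurableSet G) :
    MeasurableSet (p.event G) :=
  (measurable_snd.fst.prodMk (p.measurable_hist _)) hG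

/-- Continue a policy for `n` rounds by playing `a` on the event `G` and `a'` off `G`. -/
noncomputable def extend (p : Policy d) (n : ℕ)
    (G : Set ((unitInterval × unitInterval) × (Fin p.horizon → ℝ))) (hG : MeasurableSet G)
    (a a' : EuclideanSpace ℝ (Fin d)) (ha : ‖a‖ = 1) (ha' : ‖a'‖ = 1) : Policy d where
  horizon := p.horizon + n
  act t s h := by
    classical
    exact if ht : t < p.horizon then p.act t s h
      else if (s, fun i => h (Fin.castLE (not_lt.1 ht) i)) ∈ G then a else a'
  norm_act_le t s h := by
    split_ifs
    · exact p.norm_act_le t s h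
    · exact ha.le
    · exact ha'.le
  measurable_act t := by
    by_cases ht : t < p.horizon
    · simpa only [ht, dite_true] using p.measurable_act t
    · simp only [ht, dite_false]
      refine Measurable.ite ?_ measurable_const measurable_const
      refine (measurable_fst.prodMk (measurable_pi_lambda _ fun i => ?_)) hG
      exact (measurable_pi_apply _).comp measurable_snd

section extend

variable (p : Policy d) (n : ℕ)
    (G : Set ((unitInterval × unitInterval) × (Fin p.horizon → ℝ))) (hG : MeasurableSet G)
    (a a' : EuclideanSpace ℝ (Fin d)) (ha : ‖a‖ = 1) (ha' : ‖a'‖ = 1)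

theorem extend_action_of_lt {t : ℕ} (ht : t < p.horizon) (ω : Sample d) :
    (p.extend n G hG a a' ha ha').action t ω = p.action t ω := by
  induction t using Nat.strong_induction_on with
  | _ t ih =>
    have hh : (p.extend n G hG a a' ha ha').hist t ω = p.hist t ω := by
      funext i
      rw [hist_apply, hist_apply, ih i i.2 (i.2.trans ht)]
    rw [action_eq, action_eq, hh]
    simp only [extend, ht, dite_true]

open Classical in
theorem extend_action_of_le {t : ℕ} (ht : p.horizon ≤ t) (ω : Sample d) :
    (p.extend n G hG a a' ha ha').action t ω = if ω ∈ p.event G then a else a' := by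
  have hh : (fun i : Fin p.horizon => (p.extend n G hG a a' ha ha').hist t ω (Fin.castLE ht i)) =
      p.hist p.horizon ω := by
    funext i
    rw [hist_apply, hist_apply]
    simp only [Fin.val_castLE]
    rw [extend_action_of_lt _ _ _ _ _ _ _ _ i.2]
  rw [action_eq]
  simp only [extend, not_lt.2 ht, dite_false]
  rw [show (ω ∈ p.event G) = ((ω.2.1, p.hist p.horizon ω) ∈ G) from rfl, ← hh]
  rfl

end extend

/-- `p'` continues `p`. -/
structure Extends (p p' : Policy d) : Prop where
  horizon_le : p.horizon ≤ p'.horizon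
  action_eq : ∀ t < p.horizon, ∀ ω, p'.action t ω = p.action t ω

theorem Extends.trans {p p' p'' : Policy d} (h : p.Extends p') (h' : p'.Extends p'') :
    p.Extends p'' :=
  ⟨h.horizon_le.trans h'.horizon_le, fun t ht ω =>
    (h'.action_eq t (ht.trans_le h.horizon_le) ω).trans (h.action_eq t ht ω)⟩

/-- Extension by one block of rounds in which `a` is played on `G`. -/
theorem exists_extends_block {μ : Measure (EuclideanSpace ℝ (Fin d))} [IsProbabilityMeasure μ]
    (hμ : Integrable (fun x => x) μ) (p : Policy d) (hp : p.toAlg.IsFinitelyBIC μ) (n : ℕ)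
    {G : Set ((unitInterval × unitInterval) × (Fin p.horizon → ℝ))} (hG : MeasurableSet G)
    {a : EuclideanSpace ℝ (Fin d)} (ha : ‖a‖ = 1) {r : ℝ} (hr : 0 ≤ r)
    (hint : ∫ ω in p.event G, ω.1 ∂(sampleLaw μ) = r • a) :
    ∃ p' : Policy d, p'.toAlg.IsFinitelyBIC μ ∧ p.Extends p' ∧ p'.horizon = p.horizon + n ∧
      ∀ t, p.horizon ≤ t → ∀ ω ∈ p.event G, p'.action t ω = a := by
  classical
  -- Off the event the BIC action is the direction of the complementary integral; if that vanishes
  -- any unit vector will do.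
  obtain ⟨a', ha', r', hr', hint'⟩ : ∃ a' : EuclideanSpace ℝ (Fin d), ‖a'‖ = 1 ∧ ∃ r' : ℝ,
      0 ≤ r' ∧ ∫ ω in (p.event G)ᶜ, ω.1 ∂(sampleLaw μ) = r' • a' := by
    rcases eq_or_ne (∫ ω in (p.event G)ᶜ, ω.1 ∂(sampleLaw μ)) 0 with h0 | h0
    · exact ⟨a, ha, 0, le_rfl, by rw [h0, zero_smul]⟩
    · refine ⟨‖∫ ω in (p.event G)ᶜ, ω.1 ∂(sampleLaw μ)‖⁻¹ • ∫ ω in (p.event G)ᶜ, ω.1 ∂(sampleLaw μ),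
        norm_smul_inv_norm h0, ‖∫ ω in (p.event G)ᶜ, ω.1 ∂(sampleLaw μ)‖, norm_nonneg _, ?_⟩
      rw [smul_inv_smul₀ (norm_ne_zero_iff.2 h0)]
  refine ⟨p.extend n G hG a a' ha ha', ?_, ⟨Nat.le_add_right _ _, fun t ht ω =>
    p.extend_action_of_lt n G hG a a' ha ha' ht ω⟩, rfl, fun t ht ω hω => ?_⟩
  · intro t ht
    change t < p.horizon + n at ht
    rcases lt_or_ge t p.horizon with hlt | hge
    · obtain ⟨F, hAF, hF⟩ := hp t hlt
      have e : (p.extend n G hG a a' ha ha').toAlg.action t = p.toAlg.action t :=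
        funext fun ω => p.extend_action_of_lt n G hG a a' ha ha' hlt ω
      exact ⟨F, fun ω => by rw [e]; exact hAF ω, fun x hx => by rw [e]; exact hF x hx⟩
    · have e : (p.extend n G hG a a' ha ha').toAlg.action t =
          fun ω => if ω ∈ p.event G then a else a' :=
        funext fun ω => p.extend_action_of_le n G hG a a' ha ha' hge ω
      have hms := p.measurableSet_event hG
      have hfi : Integrable (fun ω : Sample d => ω.1) (sampleLaw μ) := hμ.comp_fst _
      rw [e]
      refine ⟨{a, a'}, fun ω => by dsimp only; split_ifs <;> simp, ?_⟩
      -- If the two actions coincide, the only level set is the whole space and the two multiples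
      -- add up.
      rcases eq_or_ne a a' with rfl | hne
      · intro x hx
        obtain rfl : x = a := by simpa using hx
        refine ⟨ha, r + r', add_nonneg hr hr', ?_⟩
        have hu : ((fun ω => if ω ∈ p.event G then x else x) ⁻¹' {x} : Set (Sample d)) =
            Set.univ := by
          ext ω; simp
        rw [hu, setIntegral_univ, add_smul, ← hint, ← hint']
        exact (integral_add_compl hms hfi).symm
      · have h1 : ((fun ω => if ω ∈ p.event G then a else a') ⁻¹' {a} : Set (Sample d)) =
            p.event G := by
          ext ω
          by_cases h : ω ∈ p.event G <;> simp [h, hne.symm]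
        have h2 : ((fun ω => if ω ∈ p.event G then a else a') ⁻¹' {a'} : Set (Sample d)) =
            (p.event G)ᶜ := by
          ext ω
          by_cases h : ω ∈ p.event G <;> simp [h, hne]
        intro x hx
        rcases Finset.mem_insert.1 hx with rfl | hx
        · refine ⟨ha, r, hr, ?_⟩
          rw [h1]
          exact hint
        · obtain rfl := Finset.mem_singleton.1 hx
          refine ⟨ha', r', hr', ?_⟩
          rw [h2]
          exact hint'
  · rw [p.extend_action_of_le n G hG a a' ha ha' ht ω, if_pos hω]

/-! ### Informed seeds: unbiased linear estimators -/

/-- On seeds in `D`, the first rounds of `p` provide an unbiased linear estimator of the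
projection of the parameter to `V`, with covariance at most `τ`. -/
def Informed (p : Policy d) (D : Set unitInterval) (V : Submodule ℝ (EuclideanSpace ℝ (Fin d)))
    (τ : ℝ) : Prop :=
  ∃ e : ℕ → unitInterval → EuclideanSpace ℝ (Fin d), (∀ t, Measurable (e t)) ∧
    (∀ t z, e t z ∈ V) ∧
    (∀ ω : Sample d, ω.2.1.1 ∈ D → ∀ v ∈ V, ∀ x : EuclideanSpace ℝ (Fin d),
      ∑ t ∈ Finset.range p.horizon,
        (inner ℝ (p.action t ω) x : ℝ) * inner ℝ (e t ω.2.1.1) v = inner ℝ x v) ∧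
    ∀ z ∈ D, ∀ v ∈ V,
      ∑ t ∈ Finset.range p.horizon, (inner ℝ (e t z) v : ℝ) ^ 2 ≤ τ * ‖v‖ ^ 2

namespace Informed

variable {p p' : Policy d} {D D' : Set unitInterval}
  {V V' : Submodule ℝ (EuclideanSpace ℝ (Fin d))} {τ τ' : ℝ}

theorem mono_set (h : p.Informed D V τ) (hD : D' ⊆ D) : p.Informed D' V τ := by
  obtain ⟨e, h1, h2, h3, h4⟩ := h
  exact ⟨e, h1, h2, fun ω hω => h3 ω (hD hω), fun z hz => h4 z (hD hz)⟩

theorem mono_var (h : p.Informed D V τ) (hτ : τ ≤ τ') : p.Informed D V τ' := by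
  obtain ⟨e, h1, h2, h3, h4⟩ := h
  exact ⟨e, h1, h2, h3, fun z hz v hv => (h4 z hz v hv).trans (by gcongr)⟩

/-- Projecting the weights to the smaller subspace does not change their pairing with its vectors.
-/
theorem mono_space (h : p.Informed D V τ) (hV : V' ≤ V) : p.Informed D V' τ := by
  obtain ⟨e, h1, h2, h3, h4⟩ := h
  have hin : ∀ t z, ∀ v ∈ V', (inner ℝ (V'.starProjection (e t z)) v : ℝ) = inner ℝ (e t z) v := by
    intro t z v hv
    rw [Submodule.inner_starProjection_left_eq_right, Submodule.starProjection_eq_self_iff.2 hv]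
  refine ⟨fun t z => V'.starProjection (e t z),
    fun t => V'.starProjection.continuous.measurable.comp (h1 t),
    fun t z => Submodule.starProjection_apply_mem _ _, fun ω hω v hv x => ?_, fun z hz v hv => ?_⟩
  · simp_rw [hin _ _ v hv]
    exact h3 ω hω v (hV hv) x
  · simp_rw [hin _ _ v hv]
    exact h4 z hz v (hV hv)

/-- The later rounds receive weight zero. -/
theorem of_extends (h : p.Informed D V τ) (hp : p.Extends p') : p'.Informed D V τ := by
  obtain ⟨e, h1, h2, h3, h4⟩ := h
  obtain ⟨n, hn⟩ := Nat.exists_eq_add_of_le hp.horizon_le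
  refine ⟨fun t z => if t < p.horizon then e t z else 0, fun t => ?_, fun t z => ?_,
    fun ω hω v hv x => ?_, fun z hz v hv => ?_⟩
  · by_cases ht : t < p.horizon
    · simpa [ht] using h1 t
    · simp [ht]
  · dsimp only
    split_ifs
    · exact h2 t z
    · exact V.zero_mem
  · rw [hn, Finset.sum_range_add, ← h3 ω hω v hv x]
    simp only [add_lt_iff_neg_left, not_lt_zero, if_false, inner_zero_left, mul_zero,
      Finset.sum_const_zero, add_zero]
    refine Finset.sum_congr rfl fun t ht => ?_
    rw [if_pos (Finset.mem_range.1 ht), hp.action_eq t (Finset.mem_range.1 ht)]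
  · rw [hn, Finset.sum_range_add]
    refine le_of_eq_of_le ?_ (h4 z hz v hv)
    simp only [add_lt_iff_neg_left, not_lt_zero, if_false, inner_zero_left,
      zero_pow two_ne_zero, Finset.sum_const_zero, add_zero]
    refine Finset.sum_congr rfl fun t ht => ?_
    rw [if_pos (Finset.mem_range.1 ht)]

/-- The weights may depend on the first seed coordinate, so each seed uses the estimator of the set
containing it. -/
theorem union (h : p.Informed D V τ) (h' : p.Informed D' V τ) (hD : MeasurableSet D) :
    p.Informed (D ∪ D') V τ := by
  classical
  obtain ⟨e, h1, h2, h3, h4⟩ := h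
  obtain ⟨e', h1', h2', h3', h4'⟩ := h'
  refine ⟨fun t z => if z ∈ D then e t z else e' t z, fun t => Measurable.ite hD (h1 t) (h1' t),
    fun t z => ?_, fun ω hω v hv x => ?_, fun z hz v hv => ?_⟩
  · dsimp only
    split_ifs
    · exact h2 t z
    · exact h2' t z
  · by_cases hz : ω.2.1.1 ∈ D
    · simp only [hz, if_true]
      exact h3 ω hz v hv x
    · simp only [hz, if_false]
      exact h3' ω (hω.resolve_left hz) v hv x
  · by_cases hz' : z ∈ D
    · simp only [hz', if_true]
      exact h4 z hz' v hv
    · simp only [hz', if_false]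
      exact h4' z (hz.resolve_left hz') v hv

/-- Playing a single unit vector `n` times. -/
theorem of_const {a : EuclideanSpace ℝ (Fin d)} (ha : ‖a‖ = 1) (hn : 0 < p.horizon)
    (hτ : 1 / (p.horizon : ℝ) ≤ τ)
    (hact : ∀ t < p.horizon, ∀ ω, p.action t ω = a) : p.Informed Set.univ (ℝ ∙ a) τ := by
  have hn' : (0 : ℝ) < p.horizon := by exact_mod_cast hn
  refine ⟨fun _ _ => (p.horizon : ℝ)⁻¹ • a, fun _ => measurable_const,
    fun _ _ => Submodule.smul_mem _ _ (Submodule.mem_span_singleton_self a),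
    fun ω _ v hv x => ?_, fun z _ v hv => ?_⟩
  · obtain ⟨β, rfl⟩ := Submodule.mem_span_singleton.1 hv
    rw [Finset.sum_congr rfl fun t ht => by rw [hact t (Finset.mem_range.1 ht)]]
    simp only [real_inner_smul_left, real_inner_smul_right, real_inner_self_eq_norm_sq, ha,
      Finset.sum_const, Finset.card_range, nsmul_eq_mul, real_inner_comm x a]
    field_simp
  · obtain ⟨β, rfl⟩ := Submodule.mem_span_singleton.1 hv
    simp only [real_inner_smul_left, real_inner_smul_right, real_inner_self_eq_norm_sq, ha,
      Finset.sum_const, Finset.card_range, nsmul_eq_mul, norm_smul, Real.norm_eq_abs, mul_one,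
      one_pow, sq_abs]
    calc (p.horizon : ℝ) * (β * (p.horizon : ℝ)⁻¹) ^ 2 = 1 / p.horizon * β ^ 2 := by
          field_simp
      _ ≤ τ * β ^ 2 := by gcongr

/-- A block in direction `a = κ v₁ + ζ b` followed by a block in direction `v₁` adds the
direction `b` to the informed subspace. -/
theorem add_direction (h : p.Informed D V τ) (hp : p.Extends p') {n : ℕ} (hn : 0 < n)
    (hhor : p'.horizon = p.horizon + (n + n)) {v₁ a b : EuclideanSpace ℝ (Fin d)} {κ ζ : ℝ}
    (hb : ‖b‖ = 1) (hbV : ∀ v ∈ V, inner ℝ b v = 0) (ha : a = κ • v₁ + ζ • b) (hζ : ζ ≠ 0)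
    (hτ : (1 + κ ^ 2) / (n * ζ ^ 2) ≤ τ)
    (hact₁ : ∀ i < n, ∀ ω : Sample d, ω.2.1.1 ∈ D → p'.action (p.horizon + i) ω = a)
    (hact₂ : ∀ i < n, ∀ ω : Sample d, ω.2.1.1 ∈ D → p'.action (p.horizon + (n + i)) ω = v₁) :
    p'.Informed D (V ⊔ ℝ ∙ b) τ := by
  obtain ⟨e, h1, h2, h3, h4⟩ := h
  have hn' : (0 : ℝ) < n := by exact_mod_cast hn
  -- Since `b = (a - κ v₁) / ζ`, the average reward of the `a`-block minus `κ` times that of the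
  -- `v₁`-block, divided by `ζ`, estimates the coordinate along `b`.
  set e' : ℕ → unitInterval → EuclideanSpace ℝ (Fin d) := fun t z =>
    if t < p.horizon then e t z else
      if t < p.horizon + n then (1 / (ζ * n)) • b else (-(κ / (ζ * n))) • b with he'
  have e0 : ∀ t < p.horizon, ∀ z, e' t z = e t z := fun t ht z => by simp [he', ht]
  have e1 : ∀ i < n, ∀ z, e' (p.horizon + i) z = (1 / (ζ * n)) • b := fun i hi z => by
    simp [he', hi]
  have e2 : ∀ i < n, ∀ z, e' (p.horizon + (n + i)) z = (-(κ / (ζ * n))) • b := fun i hi z => by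
    simp [he']
  have hconst : ∀ (f : ℕ → ℝ) (c : ℝ), (∀ i < n, f i = c) →
      ∑ i ∈ Finset.range n, f i = n * c := fun f c hf => by
    rw [Finset.sum_congr rfl fun i hi => hf i (Finset.mem_range.1 hi)]
    simp
  -- The old weights lie in `V` and so ignore the `b`-component; the two estimators, and their
  -- variance bounds, add up orthogonally.
  have hdec : ∀ v ∈ V ⊔ ℝ ∙ b, ∃ v₀ ∈ V, ∃ β : ℝ, v = v₀ + β • b ∧ inner ℝ b v = β ∧
      ‖v‖ ^ 2 = ‖v₀‖ ^ 2 + β ^ 2 ∧ ∀ t z, (inner ℝ (e t z) v : ℝ) = inner ℝ (e t z) v₀ := by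
    intro v hv
    obtain ⟨v₀, hv₀, w, hw, rfl⟩ := Submodule.mem_sup.1 hv
    obtain ⟨β, rfl⟩ := Submodule.mem_span_singleton.1 hw
    refine ⟨v₀, hv₀, β, rfl, ?_, ?_, fun t z => ?_⟩
    · rw [inner_add_right, hbV v₀ hv₀, real_inner_smul_right, real_inner_self_eq_norm_sq, hb]
      ring
    · rw [norm_add_sq_real, real_inner_smul_right, real_inner_comm, hbV v₀ hv₀, norm_smul, hb,
        Real.norm_eq_abs, mul_one, sq_abs]
      ring
    · rw [inner_add_right, real_inner_smul_right, real_inner_comm, real_inner_comm b,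
        hbV _ (h2 t z), mul_zero, add_zero, real_inner_comm]
  refine ⟨e', fun t => ?_, fun t z => ?_, fun ω hω v hv x => ?_, fun z hz v hv => ?_⟩
  · by_cases ht : t < p.horizon
    · simpa [he', ht] using h1 t
    · simp [he', ht]
  · have hbm : b ∈ V ⊔ ℝ ∙ b := Submodule.mem_sup_right (Submodule.mem_span_singleton_self b)
    simp only [he']
    split_ifs
    · exact Submodule.mem_sup_left (h2 t z)
    · exact Submodule.smul_mem _ _ hbm
    · exact Submodule.smul_mem _ _ hbm
  · obtain ⟨v₀, hv₀, β, rfl, hβ, -, hev⟩ := hdec v hv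
    rw [hhor, Finset.sum_range_add, Finset.sum_range_add,
      Finset.sum_congr rfl fun t ht => by
        rw [hp.action_eq t (Finset.mem_range.1 ht), e0 t (Finset.mem_range.1 ht), hev],
      h3 ω hω v₀ hv₀ x,
      hconst _ ((κ * inner ℝ v₁ x + ζ * inner ℝ b x) * (1 / (ζ * n) * β)) fun i hi => by
        rw [hact₁ i hi ω hω, e1 i hi, real_inner_smul_left, hβ, ha, inner_add_left,
          real_inner_smul_left, real_inner_smul_left],
      hconst _ (inner ℝ v₁ x * (-(κ / (ζ * n)) * β)) fun i hi => by
        rw [hact₂ i hi ω hω, e2 i hi, real_inner_smul_left, hβ]]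
    simp only [inner_add_right,
      real_inner_smul_right, real_inner_comm b x]
    field_simp
    ring
  · obtain ⟨v₀, hv₀, β, rfl, hβ, hnorm, hev⟩ := hdec v hv
    rw [hhor, Finset.sum_range_add, Finset.sum_range_add,
      Finset.sum_congr rfl fun t ht => by
        rw [e0 t (Finset.mem_range.1 ht), hev],
      hconst _ ((1 / (ζ * n) * β) ^ 2) fun i hi => by
        rw [e1 i hi, real_inner_smul_left, hβ],
      hconst _ ((-(κ / (ζ * n)) * β) ^ 2) fun i hi => by
        rw [e2 i hi, real_inner_smul_left, hβ], hnorm]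
    have hold := h4 z hz v₀ hv₀
    have hnew : (n : ℝ) * (1 / (ζ * n) * β) ^ 2 + n * (-(κ / (ζ * n)) * β) ^ 2 =
        (1 + κ ^ 2) / (n * ζ ^ 2) * β ^ 2 := by
      field_simp
    have : (1 + κ ^ 2) / (n * ζ ^ 2) * β ^ 2 ≤ τ * β ^ 2 := by gcongr
    rw [hnew]
    linarith

/-- A policy that is fully informed with unit covariance explores spectrally. -/
theorem spectrallyExplores {μ : Measure (EuclideanSpace ℝ (Fin d))}
    (h : p.Informed Set.univ ⊤ 1) : p.toAlg.SpectrallyExplores μ 1 := by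
  obtain ⟨e, -, -, h3, h4⟩ := h
  refine ae_of_all _ fun ω => ?_
  refine Matrix.PosSemidef.of_dotProduct_mulVec_nonneg ?_ fun x => ?_
  · refine Matrix.IsHermitian.sub ?_ (by simp [Matrix.IsHermitian])
    rw [Matrix.IsHermitian, Matrix.conjTranspose_sum]
    refine Finset.sum_congr rfl fun t _ => ?_
    simp
  · set v : EuclideanSpace ℝ (Fin d) := WithLp.toLp 2 x with hv
    have hq : star x ⬝ᵥ (((∑ t ∈ Finset.range p.horizon, Matrix.vecMulVec
        (p.toAlg.action t ω).ofLp (p.toAlg.action t ω).ofLp) -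
        (1 : ℝ) • (1 : Matrix (Fin d) (Fin d) ℝ)).mulVec x) =
        ∑ t ∈ Finset.range p.horizon, (inner ℝ (p.action t ω) v : ℝ) ^ 2 - ‖v‖ ^ 2 := by
      rw [Matrix.sub_mulVec, dotProduct_sub, Matrix.sum_mulVec, dotProduct_sum, one_smul,
        Matrix.one_mulVec]
      congr 1
      · refine Finset.sum_congr rfl fun t _ => ?_
        have h1 : (inner ℝ (p.action t ω) v : ℝ) = x ⬝ᵥ (p.toAlg.action t ω).ofLp := by
          rw [EuclideanSpace.inner_eq_star_dotProduct]
          simp [hv, action]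
        rw [Matrix.vecMulVec_mulVec, h1]
        simp [dotProduct_comm, sq]
      · rw [EuclideanSpace.norm_sq_eq]
        simp [dotProduct, hv, sq]
    change 0 ≤ star x ⬝ᵥ (((∑ t ∈ Finset.range p.horizon, Matrix.vecMulVec
        (p.toAlg.action t ω).ofLp (p.toAlg.action t ω).ofLp) -
        (1 : ℝ) • (1 : Matrix (Fin d) (Fin d) ℝ)).mulVec x)
    rw [hq]
    -- Cauchy–Schwarz with unbiasedness: `‖v‖ ^ 4` is at most `∑ ⟨A_t, v⟩ ^ 2` times `∑ ⟨e_t, v⟩ ^ 2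
    -- ≤ ‖v‖ ^ 2`. Dividing by `‖v‖ ^ 2` requires the case `v = 0` apart.
    have hcs := Finset.sum_mul_sq_le_sq_mul_sq (Finset.range p.horizon)
      (fun t => (inner ℝ (p.action t ω) v : ℝ)) (fun t => inner ℝ (e t ω.2.1.1) v)
    rw [h3 ω trivial v trivial v, real_inner_self_eq_norm_sq] at hcs
    have hb := h4 ω.2.1.1 trivial v trivial
    have hS : 0 ≤ ∑ t ∈ Finset.range p.horizon, (inner ℝ (p.action t ω) v : ℝ) ^ 2 :=
      Finset.sum_nonneg fun t _ => sq_nonneg _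
    rcases (sq_nonneg ‖v‖).eq_or_lt with h0 | h0
    · rw [← h0]
      linarith
    · nlinarith

end Informed

end Policy

/-! ### Integration over seed events and the randomizing coordinate -/

section SampleSpace

variable {d : ℕ} {μ : Measure (EuclideanSpace ℝ (Fin d))} [IsProbabilityMeasure μ]

/-- The sample point without the second seed coordinate, and the second seed coordinate. -/
def splitSeed (ω : Sample d) :
    (EuclideanSpace ℝ (Fin d) × (unitInterval × (ℕ → ℝ))) × unitInterval :=
  ((ω.1, (ω.2.1.1, ω.2.2)), ω.2.1.2)

theorem measurePreserving_splitSeed :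
    MeasurePreserving (splitSeed (d := d)) (sampleLaw μ)
      ((μ.prod ((volume : Measure unitInterval).prod noiseLaw)).prod
        (volume : Measure unitInterval)) := by
  have h1 : MeasurePreserving
      (fun a : (unitInterval × unitInterval) × (ℕ → ℝ) => ((a.1.1, a.2), a.1.2))
      (((volume : Measure unitInterval).prod (volume : Measure unitInterval)).prod noiseLaw)
      (((volume : Measure unitInterval).prod noiseLaw).prod (volume : Measure unitInterval)) :=
    ((measurePreserving_prodAssoc _ _ _).symm MeasurableEquiv.prodAssoc).comp
      (((MeasurePreserving.id (volume : Measure unitInterval)).prod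
        (Measure.measurePreserving_swap (μ := (volume : Measure unitInterval))
          (ν := noiseLaw))).comp (measurePreserving_prodAssoc _ _ _))
  exact ((measurePreserving_prodAssoc _ _ _).symm MeasurableEquiv.prodAssoc).comp
    ((MeasurePreserving.id μ).prod h1)

theorem measurePreserving_seed_noise :
    MeasurePreserving (fun ω : Sample d => (ω.2.1.1, ω.2.2)) (sampleLaw μ)
      ((volume : Measure unitInterval).prod noiseLaw) :=
  measurePreserving_snd.comp (measurePreserving_fst.comp (measurePreserving_splitSeed (μ := μ)))

theorem measurePreserving_param_seed :
    MeasurePreserving (fun ω : Sample d => (ω.1, ω.2.1.1)) (sampleLaw μ)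
      (μ.prod (volume : Measure unitInterval)) :=
  ((MeasurePreserving.id μ).prod (measurePreserving_fst (ν := noiseLaw))).comp
    (measurePreserving_fst.comp (measurePreserving_splitSeed (μ := μ)))

/-- The event that the first seed coordinate belongs to `D`. -/
def seedEvent (d : ℕ) (D : Set unitInterval) : Set (Sample d) := {ω | ω.2.1.1 ∈ D}

theorem measurableSet_seedEvent {D : Set unitInterval} (hD : MeasurableSet D) :
    MeasurableSet (seedEvent d D) :=
  measurable_snd.fst.fst hD

theorem setIntegral_seedEvent (f : EuclideanSpace ℝ (Fin d) → ℝ) (hf : Measurable f)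
    {D : Set unitInterval} (hD : MeasurableSet D) :
    ∫ ω in seedEvent d D, f ω.1 ∂(sampleLaw μ) =
      (volume : Measure unitInterval).real D * ∫ x, f x ∂μ := by
  have hmp := measurePreserving_param_seed (μ := μ)
  have h1 : ∫ ω in seedEvent d D, f ω.1 ∂(sampleLaw μ) =
      ∫ q in Set.univ ×ˢ D, f q.1 * 1 ∂(μ.prod (volume : Measure unitInterval)) := by
    rw [← hmp.map_eq, setIntegral_map (MeasurableSet.univ.prod hD)
      (f := fun q : EuclideanSpace ℝ (Fin d) × unitInterval => f q.1 * 1)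
      ((hf.comp measurable_fst).mul measurable_const).aestronglyMeasurable
      hmp.measurable.aemeasurable]
    simp only [mul_one]
    congr 2
    ext ω
    simp [seedEvent]
  rw [h1, setIntegral_prod_mul (fun x => f x) (fun _ => (1 : ℝ)) Set.univ D]
  simp [mul_comm]

theorem setLIntegral_seedEvent_le (g : unitInterval × (ℕ → ℝ) → ENNReal) (hg : Measurable g)
    {D : Set unitInterval} (hD : MeasurableSet D) {C : ENNReal}
    (h : ∀ z ∈ D, ∫⁻ w, g (z, w) ∂noiseLaw ≤ C) :
    ∫⁻ ω in seedEvent d D, g (ω.2.1.1, ω.2.2) ∂(sampleLaw μ) ≤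
      C * (volume : Measure unitInterval) D := by
  have hmp := measurePreserving_seed_noise (μ := μ)
  have h1 : ∫⁻ ω in seedEvent d D, g (ω.2.1.1, ω.2.2) ∂(sampleLaw μ) =
      ∫⁻ q in D ×ˢ Set.univ, g q ∂((volume : Measure unitInterval).prod noiseLaw) := by
    rw [← hmp.setLIntegral_comp_preimage (hD.prod MeasurableSet.univ) hg]
    congr 2
    ext ω
    simp [seedEvent]
  rw [h1, ← Measure.prod_restrict, Measure.restrict_univ, lintegral_prod _ hg.aemeasurable]
  calc ∫⁻ z in D, ∫⁻ w, g (z, w) ∂noiseLaw ≤ ∫⁻ _ in D, C := setLIntegral_mono' hD h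
    _ = C * (volume : Measure unitInterval) D := setLIntegral_const _ _

theorem volume_le_coe {r : ℝ} (h0 : 0 ≤ r) (h1 : r ≤ 1) :
    (volume : Measure unitInterval).real {u : unitInterval | (u : ℝ) ≤ r} = r := by
  have : {u : unitInterval | (u : ℝ) ≤ r} = Set.Iic ⟨r, h0, h1⟩ := by
    ext u
    simp [← Subtype.coe_le_coe]
  rw [this, Measure.real, unitInterval.volume_Iic, ENNReal.toReal_ofReal h0]

/-- Randomizing an event by the second seed coordinate. -/
theorem setIntegral_randomized (F ψ : EuclideanSpace ℝ (Fin d) × (unitInterval × (ℕ → ℝ)) → ℝ)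
    (hF : Integrable F (μ.prod ((volume : Measure unitInterval).prod noiseLaw)))
    (hψ : Measurable ψ) (h0 : ∀ q, 0 ≤ ψ q) (h1 : ∀ q, ψ q ≤ 1) :
    ∫ ω in {ω : Sample d | (ω.2.1.2 : ℝ) ≤ ψ (ω.1, (ω.2.1.1, ω.2.2))},
      F (ω.1, (ω.2.1.1, ω.2.2)) ∂(sampleLaw μ) =
    ∫ ω, ψ (ω.1, (ω.2.1.1, ω.2.2)) * F (ω.1, (ω.2.1.1, ω.2.2)) ∂(sampleLaw μ) := by
  have hmp := measurePreserving_splitSeed (μ := μ)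
  have hmq := (measurePreserving_fst (μ := μ.prod ((volume : Measure unitInterval).prod noiseLaw))
    (ν := (volume : Measure unitInterval))).comp hmp
  set S : Set ((EuclideanSpace ℝ (Fin d) × (unitInterval × (ℕ → ℝ))) × unitInterval) :=
    {q | (q.2 : ℝ) ≤ ψ q.1} with hS
  have hSm : MeasurableSet S :=
    measurableSet_le (measurable_subtype_coe.comp measurable_snd) (hψ.comp measurable_fst)
  have hL : ∫ ω in {ω : Sample d | (ω.2.1.2 : ℝ) ≤ ψ (ω.1, (ω.2.1.1, ω.2.2))},
      F (ω.1, (ω.2.1.1, ω.2.2)) ∂(sampleLaw μ) =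
      ∫ q in S, F q.1 ∂((μ.prod ((volume : Measure unitInterval).prod noiseLaw)).prod
        (volume : Measure unitInterval)) := by
    rw [← hmp.map_eq, setIntegral_map hSm
      (by rw [hmp.map_eq]; exact (hF.comp_fst _).aestronglyMeasurable) hmp.measurable.aemeasurable]
    rfl
  have hR : ∫ ω, ψ (ω.1, (ω.2.1.1, ω.2.2)) * F (ω.1, (ω.2.1.1, ω.2.2)) ∂(sampleLaw μ) =
      ∫ q, ψ q * F q ∂(μ.prod ((volume : Measure unitInterval).prod noiseLaw)) := by
    rw [← hmq.map_eq, integral_map hmq.measurable.aemeasurable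
      (by rw [hmq.map_eq]; exact hψ.aestronglyMeasurable.mul hF.aestronglyMeasurable)]
    rfl
  rw [hL, hR, ← integral_indicator hSm,
    integral_prod _ ((hF.comp_fst _).indicator hSm)]
  refine integral_congr_ae (ae_of_all _ fun q => ?_)
  -- With everything else fixed, the second coordinate falls below `ψ q` with probability `ψ q`;
  -- Fubini then replaces the event by the weight.
  have e : ∀ u : unitInterval, S.indicator (fun q => F q.1) (q, u) =
      {u : unitInterval | (u : ℝ) ≤ ψ q}.indicator (fun _ => F q) u := fun u => by
    simp [Set.indicator, hS]
  simp_rw [e]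
  rw [integral_indicator (measurableSet_le measurable_subtype_coe measurable_const),
    setIntegral_const, volume_le_coe (h0 q) (h1 q), smul_eq_mul]

end SampleSpace

/-! ### Noise of the estimator, seed by seed -/

/-- The noise of the linear estimator with weights `e`, tested against `v`. -/
noncomputable def estNoise {d : ℕ} (T : ℕ) (e : ℕ → unitInterval → EuclideanSpace ℝ (Fin d))
    (v : EuclideanSpace ℝ (Fin d)) (q : unitInterval × (ℕ → ℝ)) : ℝ :=
  ∑ t ∈ Finset.range T, q.2 t * inner ℝ (e t q.1) v

theorem measurable_estNoise {d : ℕ} (T : ℕ) {e : ℕ → unitInterval → EuclideanSpace ℝ (Fin d)}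
    (he : ∀ t, Measurable (e t)) (v : EuclideanSpace ℝ (Fin d)) :
    Measurable (estNoise T e v) := by
  unfold estNoise
  refine Finset.measurable_sum _ fun t _ => ?_
  exact ((measurable_pi_apply t).comp measurable_snd).mul
    (((he t).comp measurable_fst).inner measurable_const)

section Noise

variable {d : ℕ} {μ : Measure (EuclideanSpace ℝ (Fin d))} [IsProbabilityMeasure μ]
  {T : ℕ} {e : ℕ → unitInterval → EuclideanSpace ℝ (Fin d)} {v : EuclideanSpace ℝ (Fin d)}
  {D : Set unitInterval} {τ : ℝ}

/-- For a fixed first coordinate the weights are constants, so the bound for deterministic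
combinations applies and is integrated over `D`. -/
theorem estNoise_tail_le (he : ∀ t, Measurable (e t)) (hD : MeasurableSet D)
    (h : ∀ z ∈ D, ∑ t ∈ Finset.range T, (inner ℝ (e t z) v : ℝ) ^ 2 ≤ τ) {x : ℝ} (hx : 0 ≤ x) :
    (sampleLaw μ).real (seedEvent d D ∩ {ω | x ≤ |estNoise T e v (ω.2.1.1, ω.2.2)|}) ≤
      2 * Real.exp (-x ^ 2 / (2 * τ)) * (volume : Measure unitInterval).real D := by
  have hm := measurable_estNoise T he v
  have hms : MeasurableSet {q : unitInterval × (ℕ → ℝ) | x ≤ |estNoise T e v q|} :=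
    measurableSet_le measurable_const hm.abs
  have h1 := setLIntegral_seedEvent_le (μ := μ)
    ({q | x ≤ |estNoise T e v q|}.indicator fun _ => (1 : ENNReal))
    (measurable_const.indicator hms) hD
    (C := ENNReal.ofReal (2 * Real.exp (-x ^ 2 / (2 * τ)))) fun z hz => by
      refine le_of_eq_of_le ?_ (noise_tail_le (fun t => inner ℝ (e t z) v) T (h z hz) hx)
      have : (fun w => {q | x ≤ |estNoise T e v q|}.indicator (fun _ => (1 : ENNReal)) (z, w)) =
          {w | x ≤ |∑ t ∈ Finset.range T, w t * inner ℝ (e t z) v|}.indicator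
            fun _ => (1 : ENNReal) := by
        funext w
        simp [Set.indicator, estNoise]
      rw [this]
      exact lintegral_indicator_one ((measurable_prodMk_left (x := z)) hms)
  have h2 : ∫⁻ ω in seedEvent d D, ({q | x ≤ |estNoise T e v q|}.indicator
      fun _ => (1 : ENNReal)) (ω.2.1.1, ω.2.2) ∂(sampleLaw μ) =
      sampleLaw μ (seedEvent d D ∩ {ω | x ≤ |estNoise T e v (ω.2.1.1, ω.2.2)|}) := by
    have hmS : MeasurableSet {ω : Sample d | x ≤ |estNoise T e v (ω.2.1.1, ω.2.2)|} :=
      (measurePreserving_seed_noise (μ := μ)).measurable hms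
    have : (fun ω : Sample d => ({q | x ≤ |estNoise T e v q|}.indicator
        fun _ => (1 : ENNReal)) (ω.2.1.1, ω.2.2)) =
        {ω : Sample d | x ≤ |estNoise T e v (ω.2.1.1, ω.2.2)|}.indicator
          fun _ => (1 : ENNReal) := by
      funext ω
      simp [Set.indicator]
    rw [this, Set.inter_comm, ← Measure.restrict_apply hmS]
    exact lintegral_indicator_one hmS
  rw [h2] at h1
  have h3 := ENNReal.toReal_mono (ENNReal.mul_ne_top ENNReal.ofReal_ne_top (measure_ne_top _ _)) h1
  rwa [ENNReal.toReal_mul, ENNReal.toReal_ofReal (by positivity)] at h3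

theorem integral_abs_estNoise_le (he : ∀ t, Measurable (e t)) (hD : MeasurableSet D)
    (hτ : 0 < τ) (h : ∀ z ∈ D, ∑ t ∈ Finset.range T, (inner ℝ (e t z) v : ℝ) ^ 2 ≤ τ) :
    IntegrableOn (fun ω : Sample d => |estNoise T e v (ω.2.1.1, ω.2.2)|) (seedEvent d D)
      (sampleLaw μ) ∧
    ∫ ω in seedEvent d D, |estNoise T e v (ω.2.1.1, ω.2.2)| ∂(sampleLaw μ) ≤
      2 * √τ * (volume : Measure unitInterval).real D := by
  have hm := measurable_estNoise T he v
  have h1 := setLIntegral_seedEvent_le (μ := μ) (fun q => ENNReal.ofReal |estNoise T e v q|)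
    hm.abs.ennreal_ofReal hD (C := ENNReal.ofReal (2 * √τ)) fun z hz =>
      lintegral_abs_noise_le (fun t => inner ℝ (e t z) v) T hτ (h z hz)
  have htop := ENNReal.mul_ne_top (ENNReal.ofReal_ne_top (r := 2 * √τ))
    (measure_ne_top (volume : Measure unitInterval) D)
  have hmS : Measurable (fun ω : Sample d => |estNoise T e v (ω.2.1.1, ω.2.2)|) :=
    (hm.comp (measurePreserving_seed_noise (μ := μ)).measurable).abs
  refine ⟨(lintegral_ofReal_ne_top_iff_integrable hmS.aestronglyMeasurable
    (ae_of_all _ fun ω => abs_nonneg _)).1 (ne_top_of_le_ne_top htop h1), ?_⟩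
  rw [integral_eq_lintegral_of_nonneg_ae (ae_of_all _ fun ω => abs_nonneg _)
    hmS.aestronglyMeasurable]
  have h3 := ENNReal.toReal_mono htop h1
  rwa [ENNReal.toReal_mul, ENNReal.toReal_ofReal (by positivity)] at h3

end Noise

/-! ### Steering the integral of the parameter -/

namespace Policy

variable {d : ℕ} {μ : Measure (EuclideanSpace ℝ (Fin d))} [IsProbabilityMeasure μ]

/-- If thresholding the linear estimator on `D` reaches height `R` in every direction of `V`,
then every vector of `V` shorter than `R` is, up to a vector orthogonal to `V`, the integral of the
parameter over an event that is observable and contained in `D`. -/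
theorem exists_steering (hμ : Integrable (fun x => x) μ) (p : Policy d) {D : Set unitInterval}
    (hD : MeasurableSet D) {V : Submodule ℝ (EuclideanSpace ℝ (Fin d))}
    {e : ℕ → unitInterval → EuclideanSpace ℝ (Fin d)} (he : ∀ t, Measurable (e t))
    (heV : ∀ t z, e t z ∈ V)
    (hest : ∀ ω : Sample d, ω.2.1.1 ∈ D → ∀ v ∈ V, ∀ x : EuclideanSpace ℝ (Fin d),
      ∑ t ∈ Finset.range p.horizon,
        (inner ℝ (p.action t ω) x : ℝ) * inner ℝ (e t ω.2.1.1) v = inner ℝ x v)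
    {θ R : ℝ} (hR : 0 < R)
    (hsup : ∀ v ∈ V, ‖v‖ = 1 → R ≤ ∫ ω in seedEvent d D ∩
      {ω | θ ≤ inner ℝ v ω.1 + estNoise p.horizon e v (ω.2.1.1, ω.2.2)},
        (inner ℝ v ω.1 : ℝ) ∂(sampleLaw μ))
    {u : EuclideanSpace ℝ (Fin d)} (hu : u ∈ V) (huR : ‖u‖ < R) :
    ∃ G : Set ((unitInterval × unitInterval) × (Fin p.horizon → ℝ)), MeasurableSet G ∧
      (∀ q ∈ G, q.1.1 ∈ D) ∧
      ∀ v ∈ V, ∫ ω in p.event G, (inner ℝ v ω.1 : ℝ) ∂(sampleLaw μ) = inner ℝ v u := by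
  -- The estimator as signal plus noise. It does not involve the second seed coordinate, which is
  -- why that coordinate can be reused in every block.
  set X : EuclideanSpace ℝ (Fin d) × (unitInterval × (ℕ → ℝ)) → EuclideanSpace ℝ (Fin d) :=
    fun q => V.starProjection q.1 + ∑ t ∈ Finset.range p.horizon, q.2.2 t • e t q.2.1 with hX
  have hXm : Measurable X := by
    refine (V.starProjection.continuous.measurable.comp measurable_fst).add
      (Finset.measurable_sum _ fun t _ => ?_)
    exact ((measurable_pi_apply t).comp (measurable_snd.comp measurable_snd)).smul
      ((he t).comp (measurable_fst.comp measurable_snd))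
  have hXin : ∀ v ∈ V, ∀ q, inner ℝ v (X q) = inner ℝ v q.1 + estNoise p.horizon e v q.2 := by
    intro v hv q
    rw [hX, inner_add_right, ← Submodule.inner_starProjection_left_eq_right,
      Submodule.starProjection_eq_self_iff.2 hv, inner_sum]
    simp only [real_inner_smul_right, estNoise, real_inner_comm]
  set pr : Sample d → EuclideanSpace ℝ (Fin d) × (unitInterval × (ℕ → ℝ)) :=
    fun ω => (ω.1, (ω.2.1.1, ω.2.2)) with hpr
  have hprm : Measurable pr := by fun_prop
  have hfi : Integrable (fun ω : Sample d => ω.1) (sampleLaw μ) := hμ.comp_fst _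
  have hDm := measurableSet_seedEvent (d := d) hD
  have hint : ∀ (ψ : EuclideanSpace ℝ (Fin d) → ℝ), Measurable ψ → (∀ x, 0 ≤ ψ x) →
      (∀ x, ψ x ≤ 1) → Integrable (fun ω => ψ (X (pr ω)) • ω.1)
        ((sampleLaw μ).restrict (seedEvent d D)) := by
    intro ψ hψ h0 h1
    refine hfi.restrict.bdd_smul 1 (hψ.comp (hXm.comp hprm)).aestronglyMeasurable
      (ae_of_all _ fun ω => ?_)
    rw [Real.norm_eq_abs, Function.comp_apply, abs_of_nonneg (h0 _)]
    exact h1 _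
  have hintv : ∀ (ψ : EuclideanSpace ℝ (Fin d) → ℝ), Measurable ψ → (∀ x, 0 ≤ ψ x) →
      (∀ x, ψ x ≤ 1) → ∀ v : EuclideanSpace ℝ (Fin d),
      Integrable (fun ω => ψ (X (pr ω)) * inner ℝ v ω.1)
        ((sampleLaw μ).restrict (seedEvent d D)) := by
    intro ψ hψ h0 h1 v
    refine ((hint ψ hψ h0 h1).const_inner v).congr (ae_of_all _ fun ω => ?_)
    exact real_inner_smul_right _ _ _
  -- Events are relaxed to `[0, 1]`-valued tests of the estimate, which makes the set of attainable
  -- vectors convex.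
  set s : Set V := {y | ∃ ψ : EuclideanSpace ℝ (Fin d) → ℝ, Measurable ψ ∧ (∀ x, 0 ≤ ψ x) ∧
    (∀ x, ψ x ≤ 1) ∧ ∀ v : V, (inner ℝ (v : EuclideanSpace ℝ (Fin d)) (y : EuclideanSpace ℝ (Fin d))
      : ℝ) = ∫ ω in seedEvent d D, ψ (X (pr ω)) * inner ℝ (v : EuclideanSpace ℝ (Fin d)) ω.1
        ∂(sampleLaw μ)} with hs
  have hconv : Convex ℝ s := by
    rintro y ⟨ψ, hψ, h0, h1, hy⟩ y' ⟨ψ', hψ', h0', h1', hy'⟩ a b ha hb hab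
    refine ⟨fun x => a * ψ x + b * ψ' x, (hψ.const_mul a).add (hψ'.const_mul b), fun x => ?_,
      fun x => ?_, fun v => ?_⟩
    · have := h0 x; have := h0' x; positivity
    · nlinarith [h1 x, h1' x]
    · have hi := (hintv ψ hψ h0 h1 (v : EuclideanSpace ℝ (Fin d))).const_mul a
      have hi' := (hintv ψ' hψ' h0' h1' (v : EuclideanSpace ℝ (Fin d))).const_mul b
      simp only [Submodule.coe_add, Submodule.coe_smul, inner_add_right, real_inner_smul_right,
        hy v, hy' v, add_mul, mul_assoc]
      rw [← integral_const_mul, ← integral_const_mul, ← integral_add hi hi']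
  -- In direction `v` the height `R` is attained by the indicator of the half-space `θ ≤ ⟨v, ·⟩`;
  -- this is hypothesis `hsup`.
  have hball := ball_subset_of_convex_of_support hconv hR
    ⟨0, fun _ => 0, measurable_const, fun _ => le_rfl, fun _ => zero_le_one, fun v => by simp⟩
    fun v hv => by
      have hv' : ‖(v : EuclideanSpace ℝ (Fin d))‖ = 1 := hv
      set H : Set (EuclideanSpace ℝ (Fin d)) :=
        {y | θ ≤ inner ℝ (v : EuclideanSpace ℝ (Fin d)) y} with hH
      have hHm : MeasurableSet H := measurableSet_le measurable_const (by fun_prop)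
      have hψ : Measurable (H.indicator fun _ => (1 : ℝ)) := measurable_const.indicator hHm
      have h0 : ∀ x, 0 ≤ H.indicator (fun _ => (1 : ℝ)) x := fun x =>
        Set.indicator_nonneg (fun _ _ => zero_le_one) x
      have h1 : ∀ x, H.indicator (fun _ => (1 : ℝ)) x ≤ 1 := fun x =>
        Set.indicator_le_self' (fun _ _ => zero_le_one) x
      have hval : ∀ w : V, (inner ℝ (w : EuclideanSpace ℝ (Fin d)) (V.starProjection
          (∫ ω in seedEvent d D, H.indicator (fun _ => (1 : ℝ)) (X (pr ω)) • ω.1 ∂(sampleLaw μ)))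
          : ℝ) = ∫ ω in seedEvent d D, H.indicator (fun _ => (1 : ℝ)) (X (pr ω)) *
            inner ℝ (w : EuclideanSpace ℝ (Fin d)) ω.1 ∂(sampleLaw μ) := by
        intro w
        rw [← Submodule.inner_starProjection_left_eq_right,
          Submodule.starProjection_eq_self_iff.2 w.2,
          ← integral_inner (hint _ hψ h0 h1)]
        simp only [real_inner_smul_right]
      refine ⟨⟨_, V.starProjection_apply_mem _⟩, ⟨_, hψ, h0, h1, hval⟩, ?_⟩
      rw [Submodule.coe_inner, hval v]
      refine (hsup v v.2 hv').trans (le_of_eq ?_)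
      have hSm : MeasurableSet {ω : Sample d | θ ≤ inner ℝ (v : EuclideanSpace ℝ (Fin d)) ω.1 +
          estNoise p.horizon e v (ω.2.1.1, ω.2.2)} :=
        measurableSet_le measurable_const ((by fun_prop : Measurable fun ω : Sample d =>
          (inner ℝ (v : EuclideanSpace ℝ (Fin d)) ω.1 : ℝ)).add
          ((measurable_estNoise _ he _).comp (by fun_prop)))
      rw [← setIntegral_indicator hSm]
      refine integral_congr_ae (ae_of_all _ fun ω => ?_)
      have hiff : (X (pr ω) ∈ H) ↔ ω ∈ {ω : Sample d | θ ≤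
          inner ℝ (v : EuclideanSpace ℝ (Fin d)) ω.1 +
          estNoise p.horizon e v (ω.2.1.1, ω.2.2)} := by
        rw [hH, Set.mem_ofPred_eq, hXin v v.2]
        rfl
      by_cases hω : X (pr ω) ∈ H
      · simp [Set.indicator_of_mem hω, Set.indicator_of_mem (hiff.1 hω)]
      · simp [Set.indicator_of_notMem hω, Set.indicator_of_notMem (mt hiff.2 hω)]
  obtain ⟨ψ, hψ, h0, h1, hψu⟩ : (⟨u, hu⟩ : V) ∈ s := hball (by simpa using huR)
  set est : (unitInterval × unitInterval) × (Fin p.horizon → ℝ) → EuclideanSpace ℝ (Fin d) :=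
    fun q => ∑ i : Fin p.horizon, q.2 i • e i q.1.1 with hestdef
  have hestm : Measurable est := by
    refine Finset.measurable_sum _ fun t _ => ?_
    exact ((measurable_pi_apply t).comp measurable_snd).smul
      ((he t).comp (measurable_fst.comp measurable_fst))
  -- On `D`, the estimator computed from the observed rewards equals `X`: both lie in `V`, and
  -- unbiasedness gives the same pairing with every vector of `V`.
  have hestX : ∀ ω : Sample d, ω.2.1.1 ∈ D → est (ω.2.1, p.hist p.horizon ω) = X (pr ω) := by
    intro ω hω
    have hmem : est (ω.2.1, p.hist p.horizon ω) - X (pr ω) ∈ V := by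
      refine V.sub_mem (V.sum_mem fun i _ => V.smul_mem _ (heV _ _)) (V.add_mem
        (V.starProjection_apply_mem _) (V.sum_mem fun t _ => V.smul_mem _ (heV _ _)))
    have hzero : ∀ v ∈ V, (inner ℝ v (est (ω.2.1, p.hist p.horizon ω) - X (pr ω)) : ℝ) = 0 := by
      intro v hv
      rw [inner_sub_right, hXin v hv, hestdef]
      simp only [inner_sum, real_inner_smul_right, hist_apply]
      rw [Fin.sum_univ_eq_sum_range (fun t => ((inner ℝ (p.action t ω) ω.1 : ℝ) + ω.2.2 t) *
        inner ℝ v (e t ω.2.1.1)) p.horizon]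
      simp only [add_mul, Finset.sum_add_distrib, estNoise, hpr]
      have := hest ω hω v hv ω.1
      simp only [real_inner_comm v] at this ⊢
      rw [this]
      ring
    exact sub_eq_zero.1 (inner_self_eq_zero.1 (hzero _ hmem))
  -- The test is turned back into an event by accepting when the second coordinate is below `ψ` of
  -- the estimate.
  refine ⟨{q | q.1.1 ∈ D ∧ (q.1.2 : ℝ) ≤ ψ (est q)}, ?_, fun q hq => hq.1, fun v hv => ?_⟩
  · refine MeasurableSet.inter (measurable_fst.fst hD) (measurableSet_le ?_ (hψ.comp hestm))
    exact measurable_subtype_coe.comp measurable_fst.snd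
  · set F : EuclideanSpace ℝ (Fin d) × (unitInterval × (ℕ → ℝ)) → ℝ :=
      {q | q.2.1 ∈ D}.indicator fun q => inner ℝ v q.1 with hF
    have hDq : MeasurableSet {q : EuclideanSpace ℝ (Fin d) × (unitInterval × (ℕ → ℝ)) |
        q.2.1 ∈ D} := measurable_snd.fst hD
    have hFi : Integrable F (μ.prod ((volume : Measure unitInterval).prod noiseLaw)) :=
      Integrable.indicator ((hμ.comp_fst _).const_inner v) hDq
    have hFω : ∀ ω : Sample d, F (pr ω) =
        (seedEvent d D).indicator (fun ω => inner ℝ v ω.1) ω := fun ω => by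
      by_cases hω : ω.2.1.1 ∈ D <;> simp [hF, Set.indicator, seedEvent, hpr, hω]
    have hrand := setIntegral_randomized (μ := μ) F (fun q => ψ (X q)) hFi (hψ.comp hXm)
      (fun q => h0 _) (fun q => h1 _)
    have hset : p.event {q | q.1.1 ∈ D ∧ (q.1.2 : ℝ) ≤ ψ (est q)} =
        {ω : Sample d | (ω.2.1.2 : ℝ) ≤ ψ (X (pr ω))} ∩ seedEvent d D := by
      ext ω
      constructor
      · rintro ⟨h1, h2⟩
        refine ⟨?_, h1⟩
        rw [hestX ω h1] at h2
        exact h2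
      · rintro ⟨h1, h2⟩
        exact ⟨h2, by rw [hestX ω h2]; exact h1⟩
    have hL : ∫ ω in p.event {q | q.1.1 ∈ D ∧ (q.1.2 : ℝ) ≤ ψ (est q)},
        (inner ℝ v ω.1 : ℝ) ∂(sampleLaw μ) =
        ∫ ω in {ω : Sample d | (ω.2.1.2 : ℝ) ≤ ψ (X (pr ω))}, F (pr ω) ∂(sampleLaw μ) := by
      rw [hset, ← setIntegral_indicator hDm]
      simp only [hFω]
    have hR' : ∫ ω, ψ (X (pr ω)) * F (pr ω) ∂(sampleLaw μ) =
        ∫ ω in seedEvent d D, ψ (X (pr ω)) * inner ℝ v ω.1 ∂(sampleLaw μ) := by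
      rw [← integral_indicator hDm]
      refine integral_congr_ae (ae_of_all _ fun ω => ?_)
      simp only [hFω]
      by_cases hω : ω ∈ seedEvent d D <;> simp [hω]
    rw [hL]
    refine hrand.trans (hR'.trans ?_)
    exact (hψu ⟨v, hv⟩).symm

end Policy

namespace Policy

variable {d : ℕ} {μ : Measure (EuclideanSpace ℝ (Fin d))} [IsProbabilityMeasure μ] {B : ℝ}

namespace Informed

variable {p : Policy d} {D : Set unitInterval} {V : Submodule ℝ (EuclideanSpace ℝ (Fin d))} {τ : ℝ}

/-- Steering when the estimator noise has small tails compared to the halfspace constants. -/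
theorem exists_steering_of_halfspace (h : p.Informed D V τ) (hD : MeasurableSet D)
    (hM : MomentBound μ B) {c ε : ℝ} (hc : 0 < c) (hc1 : c ≤ 1) (hε : 0 < ε) (hε1 : ε ≤ 1)
    (hhalf : ∀ v : EuclideanSpace ℝ (Fin d), ‖v‖ = 1 → ε ≤ μ.real {x | c ≤ inner ℝ v x})
    (hτ : 2 * Real.exp (-c ^ 2 / (8 * τ)) ≤ c ^ 2 * ε ^ 2 / (16 * B))
    (hδ : 0 < (volume : Measure unitInterval).real D) {u : EuclideanSpace ℝ (Fin d)} (hu : u ∈ V)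
    (huR : ‖u‖ < (volume : Measure unitInterval).real D * (c * ε / 2)) :
    ∃ G : Set ((unitInterval × unitInterval) × (Fin p.horizon → ℝ)), MeasurableSet G ∧
      (∀ q ∈ G, q.1.1 ∈ D) ∧
      ∀ v ∈ V, ∫ ω in p.event G, (inner ℝ v ω.1 : ℝ) ∂(sampleLaw μ) = inner ℝ v u := by
  obtain ⟨e, he, heV, hest, hvar⟩ := h
  have hB := hM.pos
  refine p.exists_steering hM.integrable hD he heV hest (θ := c / 2) (by positivity)
    (fun v hv hv1 => ?_) hu huR
  set δ := (volume : Measure unitInterval).real D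
  set ξ : Sample d → ℝ := fun ω => estNoise p.horizon e v (ω.2.1.1, ω.2.2) with hξ
  have hξm : Measurable ξ := (measurable_estNoise _ he v).comp (by fun_prop)
  have hym : Measurable fun ω : Sample d => (inner ℝ v ω.1 : ℝ) := by fun_prop
  set N : Set (Sample d) := {ω | c / 2 ≤ |ξ ω|} with hN
  have hNm : MeasurableSet N := measurableSet_le measurable_const hξm.abs
  have hEm : MeasurableSet {ω : Sample d | c / 2 ≤ inner ℝ v ω.1 + ξ ω} :=
    measurableSet_le measurable_const (hym.add hξm)
  -- AM–GM parameter for `-y ≤ 1 / (2 κ) + κ y ^ 2 / 2`, used where the noise is large. With it the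
  -- quadratic and noise terms cost at most `1 / 8` and `3 / 16` of the main term `δ c ε`, leaving
  -- more than half.
  set κ := c * ε / (4 * B) with hκ
  have hκ0 : 0 < κ := by positivity
  have htail : (sampleLaw μ).real (seedEvent d D ∩ N) ≤ c ^ 2 * ε ^ 2 / (16 * B) * δ := by
    have h1 := estNoise_tail_le (μ := μ) (T := p.horizon) (e := e) (v := v) (τ := τ) he hD
      (fun z hz => by have := hvar z hz v hv; rwa [hv1, one_pow, mul_one] at this)
      (x := c / 2) (by positivity)
    refine h1.trans ?_
    rw [show -(c / 2) ^ 2 / (2 * τ) = -c ^ 2 / (8 * τ) by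
      rw [div_pow, ← neg_div, div_div]; congr 1; ring]
    exact mul_le_mul_of_nonneg_right hτ measureReal_nonneg
  have hi : Integrable (fun ω : Sample d => (inner ℝ v ω.1 : ℝ)) (sampleLaw μ) :=
    (hM.integrable_inner v).comp_fst _
  have hi2 : Integrable (fun ω : Sample d => (inner ℝ v ω.1 : ℝ) ^ 2) (sampleLaw μ) :=
    (hM.integrable_two v hv1).comp_fst _
  set H : Set (EuclideanSpace ℝ (Fin d)) := {x | c ≤ inner ℝ v x} with hH
  have hHm : MeasurableSet H := measurableSet_le measurable_const (by fun_prop)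
  have hHi : Integrable (fun ω : Sample d => c * H.indicator (fun _ => (1 : ℝ)) ω.1)
      ((sampleLaw μ).restrict (seedEvent d D)) :=
    (((integrable_const (1 : ℝ)).indicator hHm).comp_fst (μ := μ) _).restrict.const_mul c
  have hNi : Integrable (fun ω : Sample d => (c + 1 / (2 * κ)) * N.indicator (fun _ => (1 : ℝ)) ω)
      ((sampleLaw μ).restrict (seedEvent d D)) :=
    ((integrable_const (1 : ℝ)).indicator hNm).restrict.const_mul _
  rw [← setIntegral_indicator hEm]
  -- Threshold `c / 2`: when the noise is below `c / 2`, accepted points have `y > 0` and all points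
  -- of `H` are accepted.
  have hpt : ∀ ω : Sample d, c * H.indicator (fun _ => (1 : ℝ)) ω.1 -
      (c + 1 / (2 * κ)) * N.indicator (fun _ => (1 : ℝ)) ω - κ / 2 * (inner ℝ v ω.1 : ℝ) ^ 2 ≤
      {ω : Sample d | c / 2 ≤ inner ℝ v ω.1 + ξ ω}.indicator (fun ω => inner ℝ v ω.1) ω := by
    intro ω
    set y : ℝ := inner ℝ v ω.1 with hy
    have hsq : 0 ≤ κ / 2 * y ^ 2 := by positivity
    have hamgm : -y ≤ 1 / (2 * κ) + κ / 2 * y ^ 2 := by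
      have : 0 ≤ (κ * y + 1) ^ 2 / (2 * κ) := by positivity
      have e : (κ * y + 1) ^ 2 / (2 * κ) = κ / 2 * y ^ 2 + y + 1 / (2 * κ) := by
        field_simp
        ring
      linarith
    have hk : 0 < 1 / (2 * κ) := by positivity
    have hmemH : ω.1 ∈ H ↔ c ≤ y := Iff.rfl
    have hmemN : ω ∈ N ↔ c / 2 ≤ |ξ ω| := Iff.rfl
    have hmemE : ω ∈ {ω : Sample d | c / 2 ≤ inner ℝ v ω.1 + ξ ω} ↔ c / 2 ≤ y + ξ ω := Iff.rfl
    by_cases h1 : ω.1 ∈ H <;> by_cases h2 : ω ∈ N <;>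
      by_cases h3 : ω ∈ {ω : Sample d | c / 2 ≤ inner ℝ v ω.1 + ξ ω} <;>
      simp only [Set.indicator_of_mem, Set.indicator_of_notMem, h1, h2, h3, not_false_eq_true,
        mul_one, mul_zero, sub_zero] <;>
      rw [hmemH] at h1 <;> rw [hmemN] at h2 <;> rw [hmemE] at h3
    · linarith
    · linarith
    · linarith
    · have := neg_abs_le (ξ ω)
      linarith
    · linarith
    · linarith
    · have := le_abs_self (ξ ω)
      linarith
    · linarith
  have hmono := integral_mono ((hHi.sub hNi).sub (hi2.restrict.const_mul (κ / 2)))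
    (hi.indicator hEm).restrict hpt
  refine le_trans ?_ hmono
  rw [integral_sub' (hHi.sub hNi) (hi2.restrict.const_mul (κ / 2)), integral_sub' hHi hNi,
    integral_const_mul, integral_const_mul, integral_const_mul,
    setIntegral_seedEvent (fun x => H.indicator (fun _ => (1 : ℝ)) x)
      (measurable_const.indicator hHm) hD,
    setIntegral_seedEvent (fun x => (inner ℝ v x : ℝ) ^ 2) (by fun_prop) hD,
    setIntegral_indicator hNm, setIntegral_const, smul_eq_mul, mul_one, integral_indicator hHm,
    setIntegral_const, smul_eq_mul, mul_one]
  change δ * (c * ε / 2) ≤ c * (δ * μ.real H) -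
    (c + 1 / (2 * κ)) * (sampleLaw μ).real (seedEvent d D ∩ N) -
    κ / 2 * (δ * ∫ x, (inner ℝ v x : ℝ) ^ 2 ∂μ)
  have hHε : ε ≤ μ.real H := hhalf v hv1
  have hb1 : c * (δ * ε) ≤ c * (δ * μ.real H) := by gcongr
  have hb2 : κ / 2 * (δ * ∫ x, (inner ℝ v x : ℝ) ^ 2 ∂μ) ≤ κ / 2 * (δ * B) := by
    gcongr
    exact hM.two_le v hv1
  have hb3 : (c + 1 / (2 * κ)) * (sampleLaw μ).real (seedEvent d D ∩ N) ≤
      (c + 1 / (2 * κ)) * (c ^ 2 * ε ^ 2 / (16 * B) * δ) := by gcongr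
  have hb4 : κ / 2 * (δ * B) = δ * (c * ε / 8) := by
    rw [hκ]; field_simp; norm_num
  have hb5 : (c + 1 / (2 * κ)) * (c ^ 2 * ε ^ 2 / (16 * B) * δ) ≤ δ * (c * ε * (1 / 16 + 1 / 8)) := by
    have e1 : (c + 1 / (2 * κ)) * (c ^ 2 * ε ^ 2 / (16 * B) * δ) =
        δ * (c * ε * (c ^ 2 * ε / (16 * B) + 1 / 8)) := by
      rw [hκ]; field_simp; ring
    have hc2 : c ^ 2 ≤ 1 := pow_le_one₀ hc.le hc1
    have hnum : c ^ 2 * ε ≤ 1 := mul_le_one₀ hc2 hε.le hε1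
    have hfrac : c ^ 2 * ε / (16 * B) ≤ 1 / 16 :=
      div_le_div₀ zero_le_one hnum (by norm_num) (by linarith [hM.one_le])
    have := mul_le_mul_of_nonneg_left hfrac (by positivity : 0 ≤ δ * (c * ε))
    rw [e1]
    linarith
  have : 0 < δ * (c * ε) := by positivity
  nlinarith

/-- Steering in directions in which the prior is centered, from a lower bound on its variance. -/
theorem exists_steering_of_variance (h : p.Informed D V τ) (hD : MeasurableSet D)
    (hM : MomentBound μ B) {σ : ℝ} (hσ : 0 < σ)
    (hvarσ : ∀ v ∈ V, ‖v‖ = 1 → σ ≤ variance (fun x => inner ℝ v x) μ)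
    (hmean : ∀ v ∈ V, ∫ x, (inner ℝ v x : ℝ) ∂μ = 0) (hτ0 : 0 < τ)
    (hτ : 2 * √τ ≤ σ * √σ / (16 * B))
    (hδ : 0 < (volume : Measure unitInterval).real D) {u : EuclideanSpace ℝ (Fin d)} (hu : u ∈ V)
    (huR : ‖u‖ < (volume : Measure unitInterval).real D * (σ * √σ / (16 * B))) :
    ∃ G : Set ((unitInterval × unitInterval) × (Fin p.horizon → ℝ)), MeasurableSet G ∧
      (∀ q ∈ G, q.1.1 ∈ D) ∧
      ∀ v ∈ V, ∫ ω in p.event G, (inner ℝ v ω.1 : ℝ) ∂(sampleLaw μ) = inner ℝ v u := by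
  obtain ⟨e, he, heV, hest, hvar⟩ := h
  have hB := hM.pos
  have hsσ : 0 < √σ := Real.sqrt_pos.2 hσ
  refine p.exists_steering hM.integrable hD he heV hest (θ := 0) (by positivity)
    (fun v hv hv1 => ?_) hu huR
  set δ := (volume : Measure unitInterval).real D
  set ξ : Sample d → ℝ := fun ω => estNoise p.horizon e v (ω.2.1.1, ω.2.2) with hξ
  have hξm : Measurable ξ := (measurable_estNoise _ he v).comp (by fun_prop)
  have hym : Measurable fun ω : Sample d => (inner ℝ v ω.1 : ℝ) := by fun_prop
  have hEm : MeasurableSet {ω : Sample d | 0 ≤ inner ℝ v ω.1 + ξ ω} :=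
    measurableSet_le measurable_const (hym.add hξm)
  obtain ⟨hni, hnb⟩ := integral_abs_estNoise_le (μ := μ) (T := p.horizon) (e := e) (v := v) he hD
    hτ0 (fun z hz => by have := hvar z hz v hv; rwa [hv1, one_pow, mul_one] at this)
  have hi : Integrable (fun ω : Sample d => (inner ℝ v ω.1 : ℝ)) (sampleLaw μ) :=
    (hM.integrable_inner v).comp_fst _
  have hmi : Integrable (fun ω : Sample d => max (inner ℝ v ω.1 : ℝ) 0)
      ((sampleLaw μ).restrict (seedEvent d D)) := hi.pos_part.restrict
  -- Deciding by the sign of `y + ξ` instead of the sign of `y` loses at most `|ξ|`; the hypothesis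
  -- on `τ` limits this to half of the positive part.
  have hpt : ∀ ω : Sample d, max (inner ℝ v ω.1 : ℝ) 0 - |ξ ω| ≤
      {ω : Sample d | 0 ≤ inner ℝ v ω.1 + ξ ω}.indicator (fun ω => inner ℝ v ω.1) ω := by
    intro ω
    have h1 := neg_abs_le (ξ ω)
    have h2 := le_abs_self (ξ ω)
    by_cases hω : ω ∈ {ω : Sample d | 0 ≤ inner ℝ v ω.1 + ξ ω}
    · rw [Set.indicator_of_mem hω]
      have : (0 : ℝ) ≤ inner ℝ v ω.1 + ξ ω := hω
      rcases max_cases (inner ℝ v ω.1 : ℝ) 0 with ⟨h, _⟩ | ⟨h, _⟩ <;> rw [h] <;> linarith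
    · rw [Set.indicator_of_notMem hω]
      have : (inner ℝ v ω.1 : ℝ) + ξ ω < 0 := not_le.1 hω
      rcases max_cases (inner ℝ v ω.1 : ℝ) 0 with ⟨h, _⟩ | ⟨h, _⟩ <;> rw [h] <;> linarith
  rw [← setIntegral_indicator hEm]
  refine le_trans ?_ (integral_mono (hmi.sub hni) (hi.indicator hEm).restrict hpt)
  rw [integral_sub' hmi hni,
    setIntegral_seedEvent (fun x => max (inner ℝ v x : ℝ) 0) (by fun_prop) hD]
  have hpos := hM.integral_pos_part_ge hσ hv1 (hvarσ v hv hv1) (hmean v hv)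
  have h1 : δ * (σ * √σ / (8 * B)) ≤ δ * ∫ x, max (inner ℝ v x : ℝ) 0 ∂μ := by gcongr
  have h2 : 2 * √τ * δ ≤ σ * √σ / (16 * B) * δ := by gcongr
  have h3 : σ * √σ / (8 * B) = 2 * (σ * √σ / (16 * B)) := by field_simp; norm_num
  rw [h3] at h1
  change _ ≤ _ - ∫ ω in seedEvent d D, |estNoise p.horizon e v (ω.2.1.1, ω.2.2)| ∂(sampleLaw μ)
  linarith

end Informed

/-! ### Sending new seeds in a new direction -/

/-- Adjoining to an observable event contained in `D` all seeds of a disjoint set `D₀`. -/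
theorem integral_inner_event_union (hM : MomentBound μ B) (p : Policy d) {D D₀ : Set unitInterval}
    (hD₀ : MeasurableSet D₀) (hdisj : Disjoint D D₀)
    {G : Set ((unitInterval × unitInterval) × (Fin p.horizon → ℝ))}
    (hGD : ∀ q ∈ G, q.1.1 ∈ D) (v : EuclideanSpace ℝ (Fin d)) :
    inner ℝ v (∫ ω in p.event (G ∪ {q | q.1.1 ∈ D₀}), ω.1 ∂(sampleLaw μ)) =
      ∫ ω in p.event G, (inner ℝ v ω.1 : ℝ) ∂(sampleLaw μ) +
        (volume : Measure unitInterval).real D₀ * inner ℝ v (∫ x, x ∂μ) := by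
  have hfi : Integrable (fun ω : Sample d => ω.1) (sampleLaw μ) := hM.integrable.comp_fst _
  have hset : p.event (G ∪ {q | q.1.1 ∈ D₀}) = p.event G ∪ seedEvent d D₀ := rfl
  have hdis : Disjoint (p.event G) (seedEvent d D₀) :=
    Set.disjoint_left.2 fun ω h1 h2 => Set.disjoint_left.1 hdisj (hGD _ h1) h2
  rw [← integral_inner hfi.restrict, hset,
    setIntegral_union hdis (measurableSet_seedEvent hD₀) (hfi.const_inner v).integrableOn
      (hfi.const_inner v).integrableOn,
    setIntegral_seedEvent (fun x => (inner ℝ v x : ℝ)) (by fun_prop) hD₀, hM.inner_mean]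

/-- Explore a new direction `b` by recommending `a = κ v₁ + ζ b` on an event that contains all
seeds of `D₀`. -/
theorem exists_extends_explore (hM : MomentBound μ B) (p : Policy d)
    (hp : p.toAlg.IsFinitelyBIC μ) {v₁ : EuclideanSpace ℝ (Fin d)} (hv₁ : ‖v₁‖ = 1)
    (hmean : ∫ x, x ∂μ = ‖∫ x, x ∂μ‖ • v₁)
    {G : Set ((unitInterval × unitInterval) × (Fin p.horizon → ℝ))} (hG : MeasurableSet G)
    {D₀ : Set unitInterval} (hGD : ∀ q, q.1.1 ∈ D₀ → q ∈ G)
    {V : Submodule ℝ (EuclideanSpace ℝ (Fin d))} {τ : ℝ} (h : p.Informed D₀ V τ) {n : ℕ}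
    (hn : 0 < n) {a b : EuclideanSpace ℝ (Fin d)} {κ ζ r : ℝ} (ha1 : ‖a‖ = 1) (hr : 0 ≤ r)
    (hint : ∫ ω in p.event G, ω.1 ∂(sampleLaw μ) = r • a)
    (hb : ‖b‖ = 1) (hbV : ∀ v ∈ V, inner ℝ b v = 0) (ha : a = κ • v₁ + ζ • b) (hζ : ζ ≠ 0)
    (hτ : (1 + κ ^ 2) / (n * ζ ^ 2) ≤ τ) :
    ∃ p' : Policy d, p'.toAlg.IsFinitelyBIC μ ∧ p.Extends p' ∧
      p'.horizon = p.horizon + (n + n) ∧ p'.Informed D₀ (V ⊔ ℝ ∙ b) τ := by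
  obtain ⟨p₁, hp₁, hext₁, hhor₁, hact₁⟩ :=
    exists_extends_block hM.integrable p hp n hG ha1 hr hint
  -- Recommending `v₁` regardless of the history is BIC, because the prior mean is a nonnegative
  -- multiple of `v₁`.
  obtain ⟨p₂, hp₂, hext₂, hhor₂, hact₂⟩ :=
    exists_extends_block hM.integrable p₁ hp₁ n MeasurableSet.univ hv₁ (norm_nonneg _)
      (r := ‖∫ x, x ∂μ‖) (by
        rw [← hmean, show p₁.event Set.univ = Set.univ from rfl, setIntegral_univ]
        exact (integral_fun_fst (fun x : EuclideanSpace ℝ (Fin d) => x)).trans (by simp))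
  have hhor : p₂.horizon = p.horizon + (n + n) := by omega
  refine ⟨p₂, hp₂, hext₁.trans hext₂, hhor,
    h.add_direction (hext₁.trans hext₂) hn hhor hb hbV ha hζ hτ ?_ ?_⟩
  · intro i hi ω hω
    rw [hext₂.action_eq _ (by omega)]
    exact hact₁ (p.horizon + i) (by omega) ω (hGD _ hω)
  · intro i hi ω hω
    exact hact₂ (p.horizon + (n + i)) (by omega) ω trivial

end Policy

/-! ### Levels of the first seed coordinate -/

/-- The seeds at most `γ`. -/
def lowSeeds (γ : ℝ) : Set unitInterval := {z | (z : ℝ) ≤ γ}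

/-- The seeds between `a` and `b`. -/
def midSeeds (a b : ℝ) : Set unitInterval := {z | a < (z : ℝ) ∧ (z : ℝ) ≤ b}

theorem measurableSet_lowSeeds (γ : ℝ) : MeasurableSet (lowSeeds γ) :=
  measurableSet_le measurable_subtype_coe measurable_const

theorem measurableSet_midSeeds (a b : ℝ) : MeasurableSet (midSeeds a b) :=
  (measurableSet_lt measurable_const measurable_subtype_coe).inter
    (measurableSet_le measurable_subtype_coe measurable_const)

theorem disjoint_midSeeds_lowSeeds (a b : ℝ) : Disjoint (midSeeds a b) (lowSeeds a) :=
  Set.disjoint_left.2 fun _ h1 h2 => not_lt.2 h2 h1.1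

theorem lowSeeds_union_midSeeds {a b : ℝ} (h : a ≤ b) :
    lowSeeds a ∪ midSeeds a b = lowSeeds b := by
  ext z
  constructor
  · rintro (h1 | h1)
    · exact le_trans h1 h
    · exact h1.2
  · intro h1
    rcases le_or_gt (z : ℝ) a with h2 | h2
    · exact Or.inl h2
    · exact Or.inr ⟨h2, h1⟩

theorem volume_lowSeeds {γ : ℝ} (h0 : 0 ≤ γ) (h1 : γ ≤ 1) :
    (volume : Measure unitInterval).real (lowSeeds γ) = γ :=
  volume_le_coe h0 h1

theorem volume_midSeeds {a b : ℝ} (h0 : 0 ≤ a) (hab : a ≤ b) (h1 : b ≤ 1) :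
    (volume : Measure unitInterval).real (midSeeds a b) = b - a := by
  have h2 := volume_lowSeeds (h0.trans hab) h1
  rw [← lowSeeds_union_midSeeds hab,
    measureReal_union (disjoint_midSeeds_lowSeeds a b).symm (measurableSet_midSeeds a b),
    volume_lowSeeds h0 (hab.trans h1)] at h2
  linarith

theorem lowSeeds_one : lowSeeds 1 = Set.univ :=
  Set.eq_univ_of_forall fun z => z.2.2

theorem finrank_sup_span_singleton_of_inner_eq_zero {E : Type*} [NormedAddCommGroup E]
    [InnerProductSpace ℝ E] [FiniteDimensional ℝ E] {V : Submodule ℝ E} {b : E} (hb : ‖b‖ = 1)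
    (hbV : ∀ v ∈ V, inner ℝ b v = 0) :
    Module.finrank ℝ (V ⊔ ℝ ∙ b : Submodule ℝ E) = Module.finrank ℝ V + 1 := by
  have hb0 : b ≠ 0 := fun h => by simp [h] at hb
  have hinf : V ⊓ ℝ ∙ b = ⊥ := by
    rw [Submodule.eq_bot_iff]
    rintro x ⟨hx, hx'⟩
    obtain ⟨t, rfl⟩ := Submodule.mem_span_singleton.1 hx'
    have := hbV _ hx
    rw [real_inner_smul_right, real_inner_self_eq_norm_sq, hb] at this
    rw [show t = 0 by linarith, zero_smul]
  have := Submodule.finrank_sup_add_finrank_inf_eq V (ℝ ∙ b)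
  rwa [hinf, finrank_bot, add_zero, finrank_span_singleton hb0] at this

theorem exists_norm_eq_one_of_ne_top {E : Type*} [NormedAddCommGroup E]
    [InnerProductSpace ℝ E] [FiniteDimensional ℝ E] {V : Submodule ℝ E} (hV : V ≠ ⊤) :
    ∃ b : E, ‖b‖ = 1 ∧ ∀ v ∈ V, inner ℝ b v = 0 := by
  have h : Vᗮ ≠ ⊥ := fun h => hV (Submodule.orthogonal_eq_bot_iff.1 h)
  obtain ⟨x, hx, hx0⟩ := Submodule.exists_mem_ne_zero_of_ne_bot h
  exact ⟨‖x‖⁻¹ • x, norm_smul_inv_norm hx0, fun v hv => by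
    rw [real_inner_smul_left, Submodule.inner_left_of_mem_orthogonal hv hx, mul_zero]⟩

/-! ### The thinning phase -/

/-- The largest seed level carried to the next dimension in the initial exploration. -/
noncomputable def thinning (c ε B : ℝ) : ℝ := c * ε / (8 * B)

namespace Policy

variable {d : ℕ} {μ : Measure (EuclideanSpace ℝ (Fin d))} [IsProbabilityMeasure μ] {B : ℝ}

/-- One dimension more is explored by a fixed fraction of the informed seeds. -/
theorem exists_extends_thinning (hM : MomentBound μ B) (p : Policy d)
    (hp : p.toAlg.IsFinitelyBIC μ) {v₁ : EuclideanSpace ℝ (Fin d)} (hv₁ : ‖v₁‖ = 1)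
    (hmean : ∫ x, x ∂μ = ‖∫ x, x ∂μ‖ • v₁)
    {c ε : ℝ} (hc : 0 < c) (hc1 : c ≤ 1) (hε : 0 < ε) (hε1 : ε ≤ 1)
    (hhalf : ∀ v : EuclideanSpace ℝ (Fin d), ‖v‖ = 1 → ε ≤ μ.real {x | c ≤ inner ℝ v x})
    {τ : ℝ} (hτ : 2 * Real.exp (-c ^ 2 / (8 * τ)) ≤ c ^ 2 * ε ^ 2 / (16 * B))
    {γ : ℝ} (hγ : 0 < γ) (hγ1 : γ ≤ 1) {V : Submodule ℝ (EuclideanSpace ℝ (Fin d))}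
    (hV : V ≠ ⊤) (h : p.Informed (lowSeeds γ) V τ) {n : ℕ} (hn : 0 < n) (hnτ : 1 / (n : ℝ) ≤ τ) :
    ∃ (p' : Policy d) (b : EuclideanSpace ℝ (Fin d)), p'.toAlg.IsFinitelyBIC μ ∧ p.Extends p' ∧
      p'.horizon = p.horizon + (n + n) ∧ ‖b‖ = 1 ∧ (∀ v ∈ V, inner ℝ b v = 0) ∧
      p'.Informed (lowSeeds (thinning c ε B * γ)) (V ⊔ ℝ ∙ b) τ := by
  have hB := hM.pos
  set q := thinning c ε B with hq
  have hq0 : 0 < q := by rw [hq, thinning]; positivity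
  have hqB : q * B = c * ε / 8 := by rw [hq, thinning]; field_simp
  have hcε : c * ε ≤ 1 := mul_le_one₀ hc1 hε.le hε1
  have hq8 : q ≤ 1 / 8 := by
    have := hM.one_le
    nlinarith
  have hqγ : q * γ ≤ γ := by nlinarith
  have hvol := volume_midSeeds (a := q * γ) (b := γ) (by positivity) hqγ hγ1
  set m₀ := ∫ x, x ∂μ with hm₀
  -- The seeds between `qγ` and `γ` are steered to minus the contribution `qγ` times the prior mean
  -- of the seeds below `qγ`. The target has norm at most `qγB = γcε / 8`, within reach because `q ≤
  -- 1 / 8`.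
  obtain ⟨G, hG, hGD, hGint⟩ := (h.mono_set (D' := midSeeds (q * γ) γ) fun z hz => hz.2)
    |>.exists_steering_of_halfspace (measurableSet_midSeeds _ _) hM hc hc1 hε hε1 hhalf hτ
    (by rw [hvol]; nlinarith) (u := -(q * γ) • V.starProjection m₀)
    (V.smul_mem _ (V.starProjection_apply_mem _)) (by
      have h1 : ‖V.starProjection m₀‖ ≤ B :=
        (V.norm_starProjection_apply_le m₀).trans hM.norm_mean_le
      rw [hvol, norm_smul, Real.norm_eq_abs, abs_neg, abs_of_pos (by positivity)]
      have h2 : q * γ * ‖V.starProjection m₀‖ ≤ q * γ * B := by gcongr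
      have h3 : q * γ * B = γ * (c * ε) / 8 := by rw [mul_right_comm, hqB]; ring
      have h4 : 0 < γ * (c * ε) := by positivity
      nlinarith)
  set G' : Set ((unitInterval × unitInterval) × (Fin p.horizon → ℝ)) :=
    G ∪ {x | x.1.1 ∈ lowSeeds (q * γ)} with hG'
  have hG'm : MeasurableSet G' := hG.union (measurable_fst.fst (measurableSet_lowSeeds _))
  set m := ∫ ω in p.event G', ω.1 ∂(sampleLaw μ) with hm
  have hmV : ∀ v ∈ V, (inner ℝ v m : ℝ) = 0 := by
    intro v hv
    rw [hm, integral_inner_event_union hM p (measurableSet_lowSeeds _)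
      (disjoint_midSeeds_lowSeeds _ _) hGD v, hGint v hv,
      volume_lowSeeds (by positivity) (hqγ.trans hγ1), real_inner_smul_right,
      ← Submodule.inner_starProjection_left_eq_right, Submodule.starProjection_eq_self_iff.2 hv]
    ring
  -- If the total integral vanishes, every unit vector is BIC on the event, and one orthogonal to
  -- `V` is chosen.
  obtain ⟨b, hb, hbV, hmb⟩ : ∃ b : EuclideanSpace ℝ (Fin d), ‖b‖ = 1 ∧
      (∀ v ∈ V, inner ℝ b v = 0) ∧ m = ‖m‖ • b := by
    rcases eq_or_ne m 0 with h0 | h0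
    · obtain ⟨b, hb, hbV⟩ := exists_norm_eq_one_of_ne_top hV
      exact ⟨b, hb, hbV, by simp [h0]⟩
    · refine ⟨‖m‖⁻¹ • m, norm_smul_inv_norm h0, fun v hv => ?_, ?_⟩
      · rw [real_inner_smul_left, real_inner_comm, hmV v hv, mul_zero]
      · rw [smul_inv_smul₀ (norm_ne_zero_iff.2 h0)]
  -- Here the recommendation is `b` itself, so `κ = 0` and the block of `v₁` that follows has weight
  -- zero in the estimator.
  obtain ⟨p', hp', hext, hhor, hinf⟩ := exists_extends_explore hM p hp hv₁ hmean hG'm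
    (D₀ := lowSeeds (q * γ)) (fun x hx => Or.inr hx) (h.mono_set fun z hz => le_trans hz hqγ) hn
    hb (norm_nonneg m) hmb hb hbV (κ := 0) (ζ := 1) (by simp) one_ne_zero (by simpa using hnτ)
  exact ⟨p', b, hp', hext, hhor, hb, hbV, hinf⟩

/-- The initial exploration: a fraction of the seeds explores all directions. -/
theorem exists_initial_exploration (hd : 0 < d) (hM : MomentBound μ B)
    {v₁ : EuclideanSpace ℝ (Fin d)} (hv₁ : ‖v₁‖ = 1) (hmean : ∫ x, x ∂μ = ‖∫ x, x ∂μ‖ • v₁)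
    {c ε : ℝ} (hc : 0 < c) (hc1 : c ≤ 1) (hε : 0 < ε) (hε1 : ε ≤ 1)
    (hhalf : ∀ v : EuclideanSpace ℝ (Fin d), ‖v‖ = 1 → ε ≤ μ.real {x | c ≤ inner ℝ v x})
    {τ : ℝ} (hτ : 2 * Real.exp (-c ^ 2 / (8 * τ)) ≤ c ^ 2 * ε ^ 2 / (16 * B))
    {n : ℕ} (hn : 0 < n) (hnτ : 1 / (n : ℝ) ≤ τ) :
    ∃ p : Policy d, p.toAlg.IsFinitelyBIC μ ∧ p.horizon = n + (d - 1) * (n + n) ∧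
      p.Informed Set.univ (ℝ ∙ v₁) τ ∧
      p.Informed (lowSeeds (thinning c ε B ^ (d - 1))) ⊤ τ := by
  have hB := hM.pos
  have hq0 : 0 < thinning c ε B := by rw [thinning]; positivity
  have hq1 : thinning c ε B ≤ 1 := by
    rw [thinning, div_le_one (by positivity)]
    have := mul_le_one₀ hc1 hε.le hε1
    linarith [hM.one_le]
  -- The empty policy; its first block plays `v₁` for every seed, the only direction available
  -- without information.
  set p₀ : Policy d := ⟨0, fun _ _ _ => 0, fun _ _ _ => by simp, fun _ => measurable_const⟩
  have hp₀ : p₀.toAlg.IsFinitelyBIC μ := fun t ht => absurd ht (Nat.not_lt_zero t)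
  obtain ⟨p₁, hp₁, -, hhor₁, hact₁⟩ :=
    exists_extends_block hM.integrable p₀ hp₀ n MeasurableSet.univ hv₁ (norm_nonneg _)
      (r := ‖∫ x, x ∂μ‖) (by
        rw [← hmean, show p₀.event Set.univ = Set.univ from rfl, setIntegral_univ]
        exact (integral_fun_fst (fun x : EuclideanSpace ℝ (Fin d) => x)).trans (by simp))
  have hhor₁' : p₁.horizon = n := by rw [hhor₁]; exact Nat.zero_add n
  have hinf₁ : p₁.Informed Set.univ (ℝ ∙ v₁) τ :=
    Informed.of_const hv₁ (by rw [hhor₁']; exact hn) (by rw [hhor₁']; exact hnτ)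
      fun t _ ω => hact₁ t (Nat.zero_le t) ω trivial
  have loop : ∀ k, k + 1 ≤ d → ∃ (p : Policy d) (V : Submodule ℝ (EuclideanSpace ℝ (Fin d))),
      p.toAlg.IsFinitelyBIC μ ∧ p.horizon = n + k * (n + n) ∧
      p.Informed Set.univ (ℝ ∙ v₁) τ ∧ Module.finrank ℝ V = k + 1 ∧
      p.Informed (lowSeeds (thinning c ε B ^ k)) V τ := by
    intro k
    induction k with
    | zero =>
      intro _
      refine ⟨p₁, ℝ ∙ v₁, hp₁, by simpa using hhor₁', hinf₁, ?_, ?_⟩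
      · exact finrank_span_singleton fun h => by simp [h] at hv₁
      · rw [pow_zero, lowSeeds_one]
        exact hinf₁
    | succ k ih =>
      intro hk
      obtain ⟨p, V, hp, hhor, hinf, hrank, hV⟩ := ih (by omega)
      have hVtop : V ≠ ⊤ := by
        rintro rfl
        rw [finrank_top, finrank_euclideanSpace_fin] at hrank
        omega
      obtain ⟨p', b, hp', hext, hhor', hb, hbV, hinf'⟩ := exists_extends_thinning hM p hp hv₁ hmean
        hc hc1 hε hε1 hhalf hτ (pow_pos hq0 k) (pow_le_one₀ hq0.le hq1) hVtop hV hn hnτ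
      refine ⟨p', V ⊔ ℝ ∙ b, hp', by rw [hhor', hhor]; ring, hinf.of_extends hext, ?_, ?_⟩
      · rw [finrank_sup_span_singleton_of_inner_eq_zero hb hbV, hrank]
      · rw [pow_succ']
        exact hinf'
  obtain ⟨p, V, hp, hhor, hinf, hrank, hV⟩ := loop (d - 1) (by omega)
  have hVtop : V = ⊤ := by
    apply Submodule.eq_top_of_finrank_eq
    rw [hrank, finrank_euclideanSpace_fin]
    omega
  exact ⟨p, hp, hhor, hinf, hVtop ▸ hV⟩

/-! ### The doubling phase -/

/-- One more direction is explored by new seeds, steered by the fully informed seeds. -/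
theorem exists_extends_doubling_step (hM : MomentBound μ B) (p : Policy d)
    (hp : p.toAlg.IsFinitelyBIC μ) {v₁ : EuclideanSpace ℝ (Fin d)} (hv₁ : ‖v₁‖ = 1)
    (hmean : ∫ x, x ∂μ = ‖∫ x, x ∂μ‖ • v₁) {σ : ℝ} (hσ : 0 < σ)
    (hvarσ : ∀ v : EuclideanSpace ℝ (Fin d), ‖v‖ = 1 → σ ≤ variance (fun x => inner ℝ v x) μ)
    {τ : ℝ} (hτ0 : 0 < τ) (hτ : 2 * √τ ≤ σ * √σ / (16 * B)) {α α' : ℝ} (hα : 0 < α)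
    (hαα' : α ≤ α') (hα'1 : α' ≤ 1) (hα'2 : α' ≤ 2 * α)
    {V : Submodule ℝ (EuclideanSpace ℝ (Fin d))} (hv₁V : v₁ ∈ V) (hV : V ≠ ⊤)
    (hlow : p.Informed (lowSeeds α) ⊤ τ) (hmid : p.Informed (midSeeds α α') V τ)
    {n : ℕ} (hn : 0 < n)
    (hnτ : 2 / (n * ((σ * √σ / (32 * B)) / (2 * B + σ * √σ / (32 * B))) ^ 2) ≤ τ) :
    ∃ (p' : Policy d) (b : EuclideanSpace ℝ (Fin d)), p'.toAlg.IsFinitelyBIC μ ∧ p.Extends p' ∧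
      p'.horizon = p.horizon + (n + n) ∧ ‖b‖ = 1 ∧ (∀ v ∈ V, inner ℝ b v = 0) ∧
      p'.Informed (midSeeds α α') (V ⊔ ℝ ∙ b) τ := by
  have hB := hM.pos
  have hsσ : 0 < √σ := Real.sqrt_pos.2 hσ
  have hn' : (0 : ℝ) < n := by exact_mod_cast hn
  set r := σ * √σ / (32 * B) with hr
  have hr0 : 0 < r := by positivity
  have hr2 : σ * √σ / (16 * B) = 2 * r := by rw [hr]; field_simp; norm_num
  obtain ⟨b, hb, hbV⟩ := exists_norm_eq_one_of_ne_top hV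
  have hbv₁ : (inner ℝ b v₁ : ℝ) = 0 := hbV v₁ hv₁V
  -- On `W` the prior is centered, so the new seeds contribute nothing there and no cancellation is
  -- needed.
  set W : Submodule ℝ (EuclideanSpace ℝ (Fin d)) := (ℝ ∙ v₁)ᗮ with hW
  have hWmem : ∀ v, v ∈ W ↔ (inner ℝ v₁ v : ℝ) = 0 := fun v =>
    Submodule.mem_orthogonal_singleton_iff_inner_right
  have hbW : b ∈ W := (hWmem b).2 (by rw [real_inner_comm]; exact hbv₁)
  have hmeanW : ∀ v ∈ W, (inner ℝ v (∫ x, x ∂μ) : ℝ) = 0 := fun v hv => by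
    rw [hmean, real_inner_smul_right, real_inner_comm, (hWmem v).1 hv, mul_zero]
  have hvol := volume_lowSeeds hα.le (hαα'.trans hα'1)
  -- The target `α r b` has half the admissible length `2 α r`, which gives the strict inequality
  -- required.
  obtain ⟨G, hG, hGD, hGint⟩ := (hlow.mono_space (V' := W) le_top).exists_steering_of_variance
    (measurableSet_lowSeeds α) hM hσ (fun v _ hv => hvarσ v hv)
    (fun v hv => by rw [← hM.inner_mean]; exact hmeanW v hv) hτ0 hτ
    (by rw [hvol]; exact hα) (u := (α * r) • b) (W.smul_mem _ hbW) (by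
      rw [norm_smul, hb, mul_one, Real.norm_eq_abs, abs_of_pos (by positivity), hvol, hr2]
      nlinarith [mul_pos hα hr0])
  set G' : Set ((unitInterval × unitInterval) × (Fin p.horizon → ℝ)) :=
    G ∪ {x | x.1.1 ∈ midSeeds α α'} with hG'
  have hG'm : MeasurableSet G' := hG.union (measurable_fst.fst (measurableSet_midSeeds _ _))
  set m := ∫ ω in p.event G', ω.1 ∂(sampleLaw μ) with hm
  have hmW : ∀ v ∈ W, (inner ℝ v m : ℝ) = α * r * inner ℝ v b := by
    intro v hv
    rw [hm, integral_inner_event_union hM p (measurableSet_midSeeds _ _)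
      (disjoint_midSeeds_lowSeeds _ _).symm hGD v, hGint v hv, hmeanW v hv,
      real_inner_smul_right]
    ring
  set β : ℝ := inner ℝ v₁ m with hβ
  have hmdec : m = β • v₁ + (α * r) • b := by
    have hz : m - (β • v₁ + (α * r) • b) ∈ W := by
      rw [hWmem, inner_sub_right, inner_add_right, real_inner_smul_right, real_inner_smul_right,
        real_inner_self_eq_norm_sq, hv₁, (hWmem b).1 hbW, ← hβ]
      ring
    have h0 : (inner ℝ (m - (β • v₁ + (α * r) • b)) (m - (β • v₁ + (α * r) • b)) : ℝ) = 0 := by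
      rw [inner_sub_right, hmW _ hz, inner_add_right, real_inner_smul_right,
        real_inner_smul_right, real_inner_comm v₁, (hWmem _).1 hz]
      ring
    exact sub_eq_zero.1 (inner_self_eq_zero.1 h0)
  -- The event only involves seeds below `α' ≤ 2 α`. Thus both components of `m` scale like `α`, and
  -- the ratio `ζ` stays above `r / (2 B + r)` however small `α` is.
  have hβle : |β| ≤ 2 * α * B := by
    have hfi : Integrable (fun ω : Sample d => ω.1) (sampleLaw μ) := hM.integrable.comp_fst _
    have hiv : Integrable (fun ω : Sample d => (inner ℝ v₁ ω.1 : ℝ)) (sampleLaw μ) :=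
      hfi.const_inner v₁
    have h1 : β = ∫ ω in p.event G', (inner ℝ v₁ ω.1 : ℝ) ∂(sampleLaw μ) :=
      (integral_inner hfi.restrict v₁).symm
    have hsub : p.event G' ⊆ seedEvent d (lowSeeds α') := by
      rintro ω (hω | hω)
      · exact le_trans (hGD _ hω) hαα'
      · exact hω.2
    calc |β| ≤ ∫ ω in p.event G', |(inner ℝ v₁ ω.1 : ℝ)| ∂(sampleLaw μ) := by
          rw [h1]; exact abs_integral_le_integral_abs
      _ ≤ ∫ ω in seedEvent d (lowSeeds α'), |(inner ℝ v₁ ω.1 : ℝ)| ∂(sampleLaw μ) :=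
          setIntegral_mono_set hiv.abs.integrableOn (ae_of_all _ fun ω => abs_nonneg _)
            (LE.le.eventuallyLE hsub)
      _ = α' * ∫ x, |(inner ℝ v₁ x : ℝ)| ∂μ := by
          rw [setIntegral_seedEvent (fun x => |(inner ℝ v₁ x : ℝ)|) (by fun_prop)
            (measurableSet_lowSeeds α'), volume_lowSeeds (hα.le.trans hαα') hα'1]
      _ ≤ 2 * α * B := mul_le_mul hα'2 (hM.abs_le v₁ hv₁)
          (integral_nonneg fun x => abs_nonneg _) (by positivity)
  have hmsq : ‖m‖ ^ 2 = β ^ 2 + (α * r) ^ 2 := by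
    rw [hmdec, norm_add_sq_real, norm_smul, norm_smul, hv₁, hb, real_inner_smul_left,
      real_inner_smul_right, real_inner_comm, hbv₁, Real.norm_eq_abs, Real.norm_eq_abs, mul_one,
      mul_one, sq_abs, sq_abs]
    ring
  have hαr : 0 < α * r := by positivity
  have hmpos : 0 < ‖m‖ := by
    rcases (norm_nonneg m).eq_or_lt with h0 | h0
    · rw [← h0] at hmsq
      nlinarith [sq_nonneg β]
    · exact h0
  have hmle : ‖m‖ ≤ α * (2 * B + r) := by
    have h1 : ‖m‖ ≤ |β| + α * r := by
      rw [hmdec]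
      refine (norm_add_le _ _).trans (le_of_eq ?_)
      rw [norm_smul, norm_smul, hv₁, hb, Real.norm_eq_abs, Real.norm_eq_abs, abs_of_pos hαr]
      ring
    linarith
  have hκ : (β / ‖m‖) ^ 2 ≤ 1 := by
    rw [div_pow, div_le_one (by positivity), hmsq]
    nlinarith
  have hζ : r / (2 * B + r) ≤ α * r / ‖m‖ := by
    rw [div_le_div_iff₀ (by positivity) hmpos]
    nlinarith
  obtain ⟨p', hp', hext, hhor, hinf⟩ := exists_extends_explore hM p hp hv₁ hmean hG'm
    (D₀ := midSeeds α α') (fun x hx => Or.inr hx) hmid hn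
    (a := ‖m‖⁻¹ • m) (norm_smul_inv_norm (norm_ne_zero_iff.1 hmpos.ne')) (norm_nonneg m)
    (by rw [smul_inv_smul₀ hmpos.ne']) hb hbV (κ := β / ‖m‖) (ζ := α * r / ‖m‖)
    (calc ‖m‖⁻¹ • m = ‖m‖⁻¹ • (β • v₁ + (α * r) • b) := by rw [← hmdec]
      _ = _ := by rw [smul_add, smul_smul, smul_smul, div_eq_inv_mul, div_eq_inv_mul])
    (by positivity) (by
      refine le_trans ?_ hnτ
      have : 0 < r / (2 * B + r) := by positivity
      gcongr
      linarith)
  exact ⟨p', b, hp', hext, hhor, hb, hbV, hinf⟩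

/-- The fully informed seeds are doubled. -/
theorem exists_extends_doubling (hd : 0 < d) (hM : MomentBound μ B) (p : Policy d)
    (hp : p.toAlg.IsFinitelyBIC μ) {v₁ : EuclideanSpace ℝ (Fin d)} (hv₁ : ‖v₁‖ = 1)
    (hmean : ∫ x, x ∂μ = ‖∫ x, x ∂μ‖ • v₁) {σ : ℝ} (hσ : 0 < σ)
    (hvarσ : ∀ v : EuclideanSpace ℝ (Fin d), ‖v‖ = 1 → σ ≤ variance (fun x => inner ℝ v x) μ)
    {τ : ℝ} (hτ0 : 0 < τ) (hτ : 2 * √τ ≤ σ * √σ / (16 * B)) {α α' : ℝ} (hα : 0 < α)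
    (hαα' : α ≤ α') (hα'1 : α' ≤ 1) (hα'2 : α' ≤ 2 * α)
    (hinit : p.Informed Set.univ (ℝ ∙ v₁) τ) (hlow : p.Informed (lowSeeds α) ⊤ τ)
    {n : ℕ} (hn : 0 < n)
    (hnτ : 2 / (n * ((σ * √σ / (32 * B)) / (2 * B + σ * √σ / (32 * B))) ^ 2) ≤ τ) :
    ∃ p' : Policy d, p'.toAlg.IsFinitelyBIC μ ∧ p.Extends p' ∧
      p'.horizon = p.horizon + (d - 1) * (n + n) ∧ p'.Informed (lowSeeds α') ⊤ τ := by
  -- The new seeds start with the span of `v₁`, known from the initial block, and gain one dimension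
  -- per step.
  have loop : ∀ k, k + 1 ≤ d → ∃ (p' : Policy d) (V : Submodule ℝ (EuclideanSpace ℝ (Fin d))),
      p'.toAlg.IsFinitelyBIC μ ∧ p.Extends p' ∧ p'.horizon = p.horizon + k * (n + n) ∧
      v₁ ∈ V ∧ Module.finrank ℝ V = k + 1 ∧ p'.Informed (midSeeds α α') V τ := by
    intro k
    induction k with
    | zero =>
      intro _
      refine ⟨p, ℝ ∙ v₁, hp, ⟨le_rfl, fun _ _ _ => rfl⟩, by simp,
        Submodule.mem_span_singleton_self _, ?_, hinit.mono_set (Set.subset_univ _)⟩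
      exact finrank_span_singleton fun h => by simp [h] at hv₁
    | succ k ih =>
      intro hk
      obtain ⟨p₁, V, hp₁, hext₁, hhor₁, hv₁V, hrank, hV⟩ := ih (by omega)
      have hVtop : V ≠ ⊤ := by
        rintro rfl
        rw [finrank_top, finrank_euclideanSpace_fin] at hrank
        omega
      obtain ⟨p₂, b, hp₂, hext₂, hhor₂, hb, hbV, hinf₂⟩ := exists_extends_doubling_step hM p₁ hp₁
        hv₁ hmean hσ hvarσ hτ0 hτ hα hαα' hα'1 hα'2 hv₁V hVtop (hlow.of_extends hext₁) hV hn hnτ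
      refine ⟨p₂, V ⊔ ℝ ∙ b, hp₂, hext₁.trans hext₂, by rw [hhor₂, hhor₁]; ring,
        Submodule.mem_sup_left hv₁V, ?_, hinf₂⟩
      rw [finrank_sup_span_singleton_of_inner_eq_zero hb hbV, hrank]
  obtain ⟨p', V, hp', hext, hhor, -, hrank, hV⟩ := loop (d - 1) (by omega)
  have hVtop : V = ⊤ := by
    apply Submodule.eq_top_of_finrank_eq
    rw [hrank, finrank_euclideanSpace_fin]
    omega
  refine ⟨p', hp', hext, hhor, ?_⟩
  rw [← lowSeeds_union_midSeeds hαα']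
  exact (hlow.of_extends hext).union (hVtop ▸ hV) (measurableSet_lowSeeds α)

/-- After `J` doublings all seeds are fully informed. -/
theorem exists_full_exploration (hd : 0 < d) (hM : MomentBound μ B) (p : Policy d)
    (hp : p.toAlg.IsFinitelyBIC μ) {v₁ : EuclideanSpace ℝ (Fin d)} (hv₁ : ‖v₁‖ = 1)
    (hmean : ∫ x, x ∂μ = ‖∫ x, x ∂μ‖ • v₁) {σ : ℝ} (hσ : 0 < σ)
    (hvarσ : ∀ v : EuclideanSpace ℝ (Fin d), ‖v‖ = 1 → σ ≤ variance (fun x => inner ℝ v x) μ)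
    {τ : ℝ} (hτ0 : 0 < τ) (hτ : 2 * √τ ≤ σ * √σ / (16 * B)) {α : ℝ} (hα : 0 < α) (hα1 : α ≤ 1)
    (hinit : p.Informed Set.univ (ℝ ∙ v₁) τ) (hlow : p.Informed (lowSeeds α) ⊤ τ)
    {n : ℕ} (hn : 0 < n)
    (hnτ : 2 / (n * ((σ * √σ / (32 * B)) / (2 * B + σ * √σ / (32 * B))) ^ 2) ≤ τ)
    {J : ℕ} (hJ : 1 ≤ 2 ^ J * α) :
    ∃ p' : Policy d, p'.toAlg.IsFinitelyBIC μ ∧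
      p'.horizon = p.horizon + J * ((d - 1) * (n + n)) ∧ p'.Informed Set.univ ⊤ τ := by
  -- The level is capped at `1`, so doublings past full information are harmless.
  have loop : ∀ j, ∃ p' : Policy d, p'.toAlg.IsFinitelyBIC μ ∧ p.Extends p' ∧
      p'.horizon = p.horizon + j * ((d - 1) * (n + n)) ∧
      p'.Informed (lowSeeds (min 1 (2 ^ j * α))) ⊤ τ := by
    intro j
    induction j with
    | zero =>
      refine ⟨p, hp, ⟨le_rfl, fun _ _ _ => rfl⟩, by simp, ?_⟩
      rwa [pow_zero, one_mul, min_eq_right hα1]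
    | succ j ih =>
      obtain ⟨p₁, hp₁, hext₁, hhor₁, hinf₁⟩ := ih
      have hle : (2 : ℝ) ^ j * α ≤ 2 ^ (j + 1) * α := by
        rw [pow_succ]
        nlinarith [mul_pos (pow_pos (two_pos : (0 : ℝ) < 2) j) hα]
      obtain ⟨p₂, hp₂, hext₂, hhor₂, hinf₂⟩ := exists_extends_doubling hd hM p₁ hp₁ hv₁ hmean hσ
        hvarσ hτ0 hτ (α := min 1 (2 ^ j * α)) (α' := min 1 (2 ^ (j + 1) * α))
        (lt_min one_pos (by positivity)) (min_le_min le_rfl hle) (min_le_left _ _) (by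
          rcases le_total 1 ((2 : ℝ) ^ j * α) with h | h
          · rw [min_eq_left h]
            exact (min_le_left _ _).trans (by norm_num)
          · rw [min_eq_right h]
            refine (min_le_right _ _).trans (le_of_eq ?_)
            rw [pow_succ]
            ring) (hinit.of_extends hext₁) hinf₁ hn hnτ
      exact ⟨p₂, hp₂, hext₁.trans hext₂, by rw [hhor₂, hhor₁]; ring, hinf₂⟩
  obtain ⟨p', hp', -, hhor, hinf⟩ := loop J
  refine ⟨p', hp', hhor, ?_⟩
  rwa [min_eq_left hJ, lowSeeds_one] at hinf

end Policy

/-! ### Relations between the constants of the prior -/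

namespace PriorAssumption

variable {d : ℕ} {μ : Measure (EuclideanSpace ℝ (Fin d))} [IsProbabilityMeasure μ] {c ε σ K B : ℝ}

/-- The half-spaces for `v` and `-v` are disjoint because `c > 0`. -/
theorem ε_le_half (h : PriorAssumption μ c ε σ K) {v : EuclideanSpace ℝ (Fin d)} (hv : ‖v‖ = 1) :
    ε ≤ 1 / 2 := by
  have h1 := h.halfspace v hv
  have h2 := h.halfspace (-v) (by rwa [norm_neg])
  have hm : MeasurableSet {x : EuclideanSpace ℝ (Fin d) | c ≤ inner ℝ (-v) x} :=
    measurableSet_le measurable_const (by fun_prop)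
  have hdis : Disjoint {x : EuclideanSpace ℝ (Fin d) | c ≤ inner ℝ v x}
      {x | c ≤ inner ℝ (-v) x} := by
    refine Set.disjoint_left.2 fun x hx hx' => ?_
    have h3 : c ≤ inner ℝ v x := hx
    have h4 : c ≤ inner ℝ (-v) x := hx'
    rw [inner_neg_left] at h4
    linarith [h.c_pos]
  have h5 := measureReal_union (μ := μ) hdis hm
  have h6 : μ.real ({x : EuclideanSpace ℝ (Fin d) | c ≤ inner ℝ v x} ∪
      {x | c ≤ inner ℝ (-v) x}) ≤ 1 := measureReal_le_one
  linarith

theorem σ_le (h : PriorAssumption μ c ε σ K) (hM : MomentBound μ B)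
    {v : EuclideanSpace ℝ (Fin d)} (hv : ‖v‖ = 1) : σ ≤ B :=
  (h.covariance v hv).trans <| (variance_le_expectation_sq (by fun_prop)).trans (hM.two_le v hv)

/-- Markov's inequality for the fourth moment. It prevents a large `c` from making `log (1 / (σ ε
c))` too small to control `log (1 / ε)`. -/
theorem c_pow_four_mul_le (h : PriorAssumption μ c ε σ K) (hM : MomentBound μ B)
    {v : EuclideanSpace ℝ (Fin d)} (hv : ‖v‖ = 1) : c ^ 4 * ε ≤ B := by
  have h1 := mul_meas_ge_le_integral_of_nonneg (μ := μ)
    (f := fun x : EuclideanSpace ℝ (Fin d) => (inner ℝ v x : ℝ) ^ 4)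
    (ae_of_all _ fun x => by positivity) (hM.integrable_four v hv) (c ^ 4)
  refine le_trans ?_ (h1.trans (hM.four_le v hv))
  have hc := h.c_pos
  gcongr
  refine (h.halfspace v hv).trans (measureReal_mono fun x hx => ?_)
  exact pow_le_pow_left₀ hc.le hx 4

/-- The logarithmic factor of the bound controls the logarithm of the halfspace constants. -/
theorem log_halfspace_le (h : PriorAssumption μ c ε σ K) (hM : MomentBound μ B)
    {v : EuclideanSpace ℝ (Fin d)} (hv : ‖v‖ = 1) :
    Real.log (1 / (min c 1 * ε)) ≤ 2 * B * max 1 (Real.log (1 / (σ * ε * c))) := by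
  have hc := h.c_pos
  have hε := h.ε_pos
  have hσ := h.σ_pos
  have hB := hM.pos
  set L := max 1 (Real.log (1 / (σ * ε * c))) with hL
  have hL1 : 1 ≤ L := le_max_left _ _
  have hlogB : Real.log B ≤ B - 1 := Real.log_le_sub_one_of_pos hB
  have hlogB0 : 0 ≤ Real.log B := Real.log_nonneg hM.one_le
  have hlogσ : Real.log σ ≤ Real.log B := Real.log_le_log hσ (h.σ_le hM hv)
  have hLlog : -(Real.log σ + Real.log ε + Real.log c) ≤ L := by
    refine le_trans (le_of_eq ?_) (le_max_right _ _)
    rw [one_div, Real.log_inv, Real.log_mul (by positivity) hc.ne', Real.log_mul hσ.ne' hε.ne']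
  rw [one_div, Real.log_inv, Real.log_mul (by positivity) hε.ne']
  have hBL : B - 1 ≤ (B - 1) * L := by nlinarith [hM.one_le]
  rcases le_total c 1 with h1 | h1
  · rw [min_eq_left h1]
    nlinarith
  · rw [min_eq_right h1, Real.log_one]
    have h4 := Real.log_le_log (by positivity) (h.c_pow_four_mul_le hM hv)
    rw [Real.log_mul (by positivity) hε.ne', Real.log_pow] at h4
    push_cast at h4
    nlinarith

end PriorAssumption

/-! ### Length of the phases -/

/-- The bound on the length of the first exploration phase. -/
lemma initial_length_le {B L Λ σ c x : ℝ} (hB1 : 1 ≤ B) (hL1 : 1 ≤ L) (hσ : 0 < σ) (hσB : σ ≤ B)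
    (hc : 0 < c) (hΛpos : 0 < Λ) (hΛle : Λ ≤ 36 * (B * L))
    (hx : x ≤ 1 / (min c 1 ^ 2 / (8 * Λ)) + 1 / (σ ^ 3 / (1024 * B ^ 3)) + 1) :
    x ≤ L * (288 * B * (1 / c ^ 2) + 2400 * (B ^ 7 * (1 / σ ^ 6))) := by
  have hB : 0 < B := by linarith
  obtain ⟨s, hs⟩ : ∃ s, s = 1 / σ ^ 6 := ⟨_, rfl⟩
  rw [← hs]
  have hs0 : 0 < s := by rw [hs]; positivity
  have hσ3 : σ ^ 3 ≤ B ^ 3 := by gcongr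
  -- Since `σ ≤ B`, terms without `1 / σ ^ 6` can be absorbed into multiples of it at the cost of
  -- powers of `B`.
  have hB6s : 1 ≤ B ^ 6 * s := by
    rw [hs, mul_one_div, le_div_iff₀ (by positivity), one_mul]
    gcongr
  have hc'0 : 0 < min c 1 := lt_min hc one_pos
  have h2 : 1 / (min c 1 ^ 2 / (8 * Λ)) ≤ 288 * (B * L) * (1 + 1 / c ^ 2) := by
    have e : 1 / (min c 1 ^ 2 / (8 * Λ)) = 8 * Λ * (1 / min c 1 ^ 2) := by field_simp
    have hcc : 1 / min c 1 ^ 2 ≤ 1 + 1 / c ^ 2 := by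
      have : 0 < 1 / c ^ 2 := by positivity
      rcases le_total c 1 with h1 | h1
      · rw [min_eq_left h1]
        linarith
      · rw [min_eq_right h1]
        linarith
    rw [e]
    calc 8 * Λ * (1 / min c 1 ^ 2) ≤ 8 * (36 * (B * L)) * (1 + 1 / c ^ 2) := by gcongr
      _ = _ := by ring
  have h3 : 1 / (σ ^ 3 / (1024 * B ^ 3)) ≤ 1024 * (B ^ 6 * s) := by
    have e : 1 / (σ ^ 3 / (1024 * B ^ 3)) = 1024 * (B ^ 3 * (1 / σ ^ 3)) * 1 := by field_simp
    have e2 : 1024 * (B ^ 6 * s) = 1024 * (B ^ 3 * (1 / σ ^ 3)) * (B ^ 3 / σ ^ 3) := by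
      rw [hs]; field_simp
    rw [e, e2]
    gcongr
    rwa [le_div_iff₀ (by positivity), one_mul]
  have hLB : 0 < L * B := by positivity
  have h5 : B * L ≤ L * (B ^ 7 * s) := by
    calc B * L = L * B * 1 := by ring
      _ ≤ L * B * (B ^ 6 * s) := by gcongr
      _ = _ := by ring
  have h6 : B ^ 6 * s ≤ L * (B ^ 7 * s) := by
    calc B ^ 6 * s = 1 * (1 * (B ^ 6 * s)) := by ring
      _ ≤ L * (B * (B ^ 6 * s)) := by gcongr
      _ = _ := by ring
  calc x ≤ 288 * (B * L) * (1 + 1 / c ^ 2) + 1024 * (B ^ 6 * s) + 1 := by linarith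
    _ = L * (288 * B * (1 / c ^ 2)) + (288 * (B * L) + 1024 * (B ^ 6 * s) + 1) := by ring
    _ ≤ L * (288 * B * (1 / c ^ 2)) + 2400 * (L * (B ^ 7 * s)) := by linarith
    _ = _ := by ring

/-- The bound on the length of one round of the doubling phase. -/
lemma doubling_length_le {B σ τ ζ x : ℝ} (hB1 : 1 ≤ B) (hσ : 0 < σ) (hσB : σ ≤ B)
    (hτ : τ = σ ^ 3 / (1024 * B ^ 3)) (hζ : σ ^ 3 / (9216 * B ^ 4) ≤ ζ ^ 2)
    (hx : x ≤ 2 / (ζ ^ 2 * τ) + 1) : x ≤ 18874369 * (B ^ 7 * (1 / σ ^ 6)) := by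
  have hB : 0 < B := by linarith
  have hτ0 : 0 < τ := by rw [hτ]; positivity
  have h1 : 1 ≤ B ^ 7 * (1 / σ ^ 6) := by
    rw [mul_one_div, le_div_iff₀ (by positivity), one_mul]
    calc σ ^ 6 ≤ B ^ 6 := by gcongr
      _ ≤ B ^ 7 := pow_le_pow_right₀ hB1 (by norm_num)
  have h2 : 2 / (ζ ^ 2 * τ) ≤ 2 / (σ ^ 3 / (9216 * B ^ 4) * τ) := by gcongr
  have h3 : 2 / (σ ^ 3 / (9216 * B ^ 4) * τ) = 18874368 * (B ^ 7 * (1 / σ ^ 6)) := by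
    rw [hτ]
    field_simp
    norm_num
  linarith

/-- The total length of both phases. -/
lemma total_length_le {d B L σ c n₁ n₂ j : ℝ} (hd1 : 1 ≤ d) (hB1 : 1 ≤ B) (hL1 : 1 ≤ L)
    (hσ : 0 < σ) (hc : 0 < c) (hn₁R : 0 ≤ n₁) (hn₂R : 0 ≤ n₂) (hjR : 0 ≤ j)
    (hn₁ : n₁ ≤ L * (288 * B * (1 / c ^ 2) + 2400 * (B ^ 7 * (1 / σ ^ 6))))
    (hn₂ : n₂ ≤ 18874369 * (B ^ 7 * (1 / σ ^ 6))) (hj : j ≤ 21 * (B * L)) :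
    n₁ + (d - 1) * (n₁ + n₁) + j * (d - 1) * ((d - 1) * (n₂ + n₂)) ≤
      10 ^ 9 * B ^ 8 * L * (d ^ 2 / σ ^ 6 + d / c ^ 2) := by
  have hB : 0 < B := by linarith
  have hd0 : 0 < d := by linarith
  obtain ⟨s, hs⟩ : ∃ s, s = 1 / σ ^ 6 := ⟨_, rfl⟩
  rw [← hs] at hn₁ hn₂
  have hs0 : 0 < s := by rw [hs]; positivity
  have hA : n₁ + (d - 1) * (n₁ + n₁) ≤ 2 * d * n₁ := by linarith
  have hBd : j * (d - 1) * ((d - 1) * (n₂ + n₂)) ≤ 2 * d ^ 2 * (j * n₂) := by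
    have h1 : (d - 1) ^ 2 ≤ d ^ 2 := by
      have : 0 ≤ d - 1 := by linarith
      gcongr
      linarith
    calc j * (d - 1) * ((d - 1) * (n₂ + n₂)) = 2 * (d - 1) ^ 2 * (j * n₂) := by ring
      _ ≤ 2 * d ^ 2 * (j * n₂) := by gcongr
  have hjn : j * n₂ ≤ 21 * (B * L) * (18874369 * (B ^ 7 * s)) := by gcongr
  have hfin1 : 2 * d * n₁ ≤
      2 * d * (L * (288 * B * (1 / c ^ 2) + 2400 * (B ^ 7 * s))) := by gcongr
  have hfin2 : 2 * d ^ 2 * (j * n₂) ≤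
      2 * d ^ 2 * (21 * (B * L) * (18874369 * (B ^ 7 * s))) := by gcongr
  have hdd : d ≤ d ^ 2 := le_self_pow₀ hd1 (by norm_num)
  have hB8 : B ^ 7 ≤ B ^ 8 := pow_le_pow_right₀ hB1 (by norm_num)
  have hBB8 : B ≤ B ^ 8 := le_self_pow₀ hB1 (by norm_num)
  have hterm1 : d * (L * (B * (1 / c ^ 2))) ≤ L * B ^ 8 * (d / c ^ 2) := by
    calc d * (L * (B * (1 / c ^ 2))) = L * B * (d / c ^ 2) := by ring
      _ ≤ L * B ^ 8 * (d / c ^ 2) := by gcongr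
  have hterm2 : d * (L * (B ^ 7 * s)) ≤ L * B ^ 8 * (d ^ 2 / σ ^ 6) := by
    calc d * (L * (B ^ 7 * s)) ≤ d ^ 2 * (L * (B ^ 8 * s)) := by gcongr
      _ = L * B ^ 8 * (d ^ 2 / σ ^ 6) := by rw [hs]; ring
  have hterm3 : d ^ 2 * (B * L * (B ^ 7 * s)) = L * B ^ 8 * (d ^ 2 / σ ^ 6) := by
    rw [hs]; ring
  have hpos1 : 0 ≤ L * B ^ 8 * (d / c ^ 2) := by positivity
  have hpos2 : 0 ≤ L * B ^ 8 * (d ^ 2 / σ ^ 6) := by positivity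
  calc _ ≤ 2 * d * n₁ + 2 * d ^ 2 * (j * n₂) := by linarith
    _ ≤ 576 * (d * (L * (B * (1 / c ^ 2)))) + 4800 * (d * (L * (B ^ 7 * s))) +
        792723498 * (d ^ 2 * (B * L * (B ^ 7 * s))) := by linarith
    _ ≤ 10 ^ 9 * (L * B ^ 8 * (d ^ 2 / σ ^ 6)) + 10 ^ 9 * (L * B ^ 8 * (d / c ^ 2)) := by
        linarith
    _ = _ := by ring

set_option maxHeartbeats 400000 in
/-- A policy that is fully informed with unit covariance, with explicitly bounded horizon. -/
theorem exists_policy {d : ℕ} (hd : 0 < d) {μ : Measure (EuclideanSpace ℝ (Fin d))}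
    [IsProbabilityMeasure μ] {c ε σ K B : ℝ} (h : PriorAssumption μ c ε σ K)
    (hM : MomentBound μ B) :
    ∃ p : Policy d, p.toAlg.IsFinitelyBIC μ ∧ p.Informed Set.univ ⊤ 1 ∧
      (p.horizon : ℝ) ≤ 10 ^ 9 * B ^ 8 * max 1 (Real.log (1 / (σ * ε * c))) *
        ((d : ℝ) ^ 2 / σ ^ 6 + d / c ^ 2) := by
  have hc := h.c_pos
  have hε := h.ε_pos
  have hσ := h.σ_pos
  have hB := hM.pos
  have hB1 := hM.one_le
  obtain ⟨v₁, hv₁, hmean⟩ : ∃ v₁ : EuclideanSpace ℝ (Fin d), ‖v₁‖ = 1 ∧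
      ∫ x, x ∂μ = ‖∫ x, x ∂μ‖ • v₁ := by
    rcases eq_or_ne (∫ x, x ∂μ) 0 with h0 | h0
    · exact ⟨EuclideanSpace.single ⟨0, hd⟩ 1, by simp, by simp [h0]⟩
    · exact ⟨‖∫ x, x ∂μ‖⁻¹ • ∫ x, x ∂μ, norm_smul_inv_norm h0, by
        rw [smul_inv_smul₀ (norm_ne_zero_iff.2 h0)]⟩
  have hε1 : ε ≤ 1 := (h.ε_le_half hv₁).trans (by norm_num)
  have hσB := h.σ_le hM hv₁
  set L := max 1 (Real.log (1 / (σ * ε * c))) with hL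
  have hL1 : 1 ≤ L := le_max_left _ _
  -- Lowering `c` to at most `1` keeps the half-space condition and meets the normalization of the
  -- thinning phase.
  set c' := min c 1 with hc'
  have hc'0 : 0 < c' := lt_min hc one_pos
  have hc'1 : c' ≤ 1 := min_le_right _ _
  have hhalf : ∀ v : EuclideanSpace ℝ (Fin d), ‖v‖ = 1 → ε ≤ μ.real {x | c' ≤ inner ℝ v x} :=
    fun v hv => (h.halfspace v hv).trans
      (measureReal_mono fun x (hx : c ≤ inner ℝ v x) => (min_le_left c 1).trans hx)
  have hℓ : Real.log (1 / (c' * ε)) ≤ 2 * B * L := h.log_halfspace_le hM hv₁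
  clear_value L c'
  have hBL : B ≤ B * L := by nlinarith
  -- Chosen so that `2 * exp (-Λ)` is exactly the tail allowed in the thinning phase; `τ₁` makes the
  -- exponent equal to `-Λ`.
  set Λ := Real.log (32 * B / (c' ^ 2 * ε ^ 2)) with hΛ
  clear_value Λ
  have hcε1 : c' ^ 2 * ε ^ 2 ≤ 1 :=
    mul_le_one₀ (pow_le_one₀ hc'0.le hc'1) (by positivity) (pow_le_one₀ hε.le hε1)
  have hΛpos : 0 < Λ := by
    rw [hΛ]
    refine Real.log_pos ?_
    rw [lt_div_iff₀ (by positivity)]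
    linarith
  have hΛle : Λ ≤ 36 * (B * L) := by
    have e : 32 * B / (c' ^ 2 * ε ^ 2) = 32 * B * (1 / (c' * ε)) ^ 2 := by
      field_simp
    rw [hΛ, e, Real.log_mul (by positivity) (by positivity), Real.log_pow]
    have := Real.log_le_sub_one_of_pos (show (0 : ℝ) < 32 * B by positivity)
    push_cast
    linarith
  set τ₁ := c' ^ 2 / (8 * Λ) with hτ₁
  clear_value τ₁
  have hτ₁0 : 0 < τ₁ := by rw [hτ₁]; positivity
  -- Precision for the doubling phase: `√τ₂ ≤ r` below, and `σ ≤ B` gives `τ₂ ≤ 1`, hence unit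
  -- covariance at the end.
  set τ₂ := σ ^ 3 / (1024 * B ^ 3) with hτ₂
  clear_value τ₂
  have hτ₂0 : 0 < τ₂ := by rw [hτ₂]; positivity
  have hσ3 : σ ^ 3 ≤ B ^ 3 := by gcongr
  have hτ₂1 : τ₂ ≤ 1 := by
    rw [hτ₂, div_le_one (by positivity)]
    nlinarith [pow_pos hB 3]
  have hτ : 2 * Real.exp (-c' ^ 2 / (8 * min τ₁ τ₂)) ≤ c' ^ 2 * ε ^ 2 / (16 * B) := by
    have h1 : -c' ^ 2 / (8 * min τ₁ τ₂) ≤ -Λ := by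
      rw [neg_div, neg_le_neg_iff, le_div_iff₀ (by positivity)]
      calc Λ * (8 * min τ₁ τ₂) ≤ Λ * (8 * τ₁) := by
            gcongr
            exact min_le_left _ _
        _ = c' ^ 2 := by rw [hτ₁]; field_simp
    have h2 := Real.exp_le_exp.2 h1
    rw [Real.exp_neg, hΛ, Real.exp_log (by positivity), inv_div] at h2
    have h3 : 2 * (c' ^ 2 * ε ^ 2 / (32 * B)) = c' ^ 2 * ε ^ 2 / (16 * B) := by
      field_simp
      norm_num
    linarith
  -- The seeds informed in the first phase steer in the second, so their estimator must meet both
  -- precisions.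
  set n₁ := ⌈1 / τ₁ + 1 / τ₂⌉₊ with hn₁
  have hn₁0 : 0 < n₁ := Nat.ceil_pos.2 (by positivity)
  have hn₁ge : 1 / τ₁ + 1 / τ₂ ≤ n₁ := Nat.le_ceil _
  clear_value n₁
  have hn₁τ : 1 / (n₁ : ℝ) ≤ min τ₁ τ₂ := by
    have hpos : (0 : ℝ) < n₁ := by exact_mod_cast hn₁0
    have ht₁ : 0 < 1 / τ₁ := by positivity
    have ht₂ : 0 < 1 / τ₂ := by positivity
    exact le_min ((one_div_le hpos hτ₁0).2 (by linarith)) ((one_div_le hpos hτ₂0).2 (by linarith))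
  obtain ⟨p, hp, hhor, hinit, hlow⟩ := Policy.exists_initial_exploration hd hM hv₁ hmean hc'0 hc'1
    hε hε1 hhalf hτ hn₁0 hn₁τ
  set q := thinning c' ε B with hq
  clear_value q
  have hq0 : 0 < q := by rw [hq, thinning]; positivity
  have hq1 : q ≤ 1 := by
    rw [hq, thinning, div_le_one (by positivity)]
    have := mul_le_one₀ hc'1 hε.le hε1
    linarith
  have hlogq : Real.log (1 / q) ≤ 10 * (B * L) := by
    have e : 1 / q = 8 * B * (1 / (c' * ε)) := by
      rw [hq, thinning]
      field_simp
    rw [e, Real.log_mul (by positivity) (by positivity)]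
    have := Real.log_le_sub_one_of_pos (show (0 : ℝ) < 8 * B by positivity)
    linarith
  have hlogq0 : 0 ≤ Real.log (1 / q) := Real.log_nonneg (by rw [le_div_iff₀ hq0]; linarith)
  -- As `2 * log 2 ≥ 1`, `j` doublings undo one factor `q`; `j * (d - 1)` of them undo the whole
  -- thinning.
  set j := ⌈2 * Real.log (1 / q)⌉₊ with hj
  have hjle : (j : ℝ) ≤ 21 * (B * L) := by
    have := Nat.ceil_lt_add_one (show 0 ≤ 2 * Real.log (1 / q) by positivity)
    rw [← hj] at this
    clear_value j
    linarith
  have hjq : 1 ≤ 2 ^ j * q := by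
    have h1 : 2 * Real.log (1 / q) ≤ j := Nat.le_ceil _
    clear_value j
    have h2 : Real.log (1 / q) ≤ j * Real.log 2 := by nlinarith [Real.log_two_gt_d9]
    have h3 := Real.exp_le_exp.2 h2
    rw [Real.exp_log (by positivity), Real.exp_nat_mul, Real.exp_log two_pos,
      div_le_iff₀ hq0] at h3
    exact h3
  have hsσ : √σ ^ 2 = σ := Real.sq_sqrt hσ.le
  have hsσ0 : 0 < √σ := Real.sqrt_pos.2 hσ
  set r := σ * √σ / (32 * B) with hr
  clear_value r
  have hr0 : 0 < r := by rw [hr]; positivity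
  have hr2 : r ^ 2 = σ ^ 3 / (1024 * B ^ 2) := by
    rw [hr, div_pow, mul_pow, hsσ]
    ring
  have hrB : r ≤ B := by
    have hsB : √σ ≤ B := by
      rw [Real.sqrt_le_left hB.le]
      nlinarith
    rw [hr, div_le_iff₀ (by positivity)]
    have : σ * √σ ≤ B * B := mul_le_mul hσB hsB hsσ0.le hB.le
    nlinarith [mul_pos hB hB]
  have hτ₂' : 2 * √τ₂ ≤ σ * √σ / (16 * B) := by
    have h1 : √τ₂ ≤ r := by
      rw [Real.sqrt_le_left hr0.le, hr2, hτ₂]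
      gcongr
      · norm_num
    have h2 : σ * √σ / (16 * B) = 2 * r := by rw [hr]; field_simp; norm_num
    linarith
  set ζ := r / (2 * B + r) with hζ
  clear_value ζ
  have hζ0 : 0 < ζ := by rw [hζ]; positivity
  have hζge : σ ^ 3 / (9216 * B ^ 4) ≤ ζ ^ 2 := by
    have h1 : r / (3 * B) ≤ ζ := by
      rw [hζ]
      gcongr
      linarith
    have h2 : (r / (3 * B)) ^ 2 ≤ ζ ^ 2 := by gcongr
    refine le_of_eq_of_le ?_ h2
    rw [div_pow, hr2]
    field_simp
    norm_num
  set n₂ := ⌈2 / (ζ ^ 2 * τ₂)⌉₊ with hn₂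
  have hn₂0 : 0 < n₂ := Nat.ceil_pos.2 (by positivity)
  have hn₂τ : 2 / (n₂ * ζ ^ 2) ≤ τ₂ := by
    have h1 : 2 / (ζ ^ 2 * τ₂) ≤ n₂ := Nat.le_ceil _
    have hpos : (0 : ℝ) < n₂ := by exact_mod_cast hn₂0
    rw [div_le_iff₀ (by positivity)] at h1 ⊢
    linarith
  obtain ⟨p', hp', hhor', hinf'⟩ := Policy.exists_full_exploration hd hM p hp hv₁ hmean hσ
    h.covariance hτ₂0 hτ₂' (α := q ^ (d - 1)) (pow_pos hq0 _) (pow_le_one₀ hq0.le hq1)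
    (hinit.mono_var (min_le_right _ _)) (hlow.mono_var (min_le_right _ _)) hn₂0
    (by rwa [← hr, ← hζ])
    (J := j * (d - 1)) (by
      rw [pow_mul, ← mul_pow]
      exact one_le_pow₀ hjq)
  refine ⟨p', hp', hinf'.mono_var hτ₂1, ?_⟩
  have hd1 : (1 : ℝ) ≤ d := by exact_mod_cast hd
  have hd0 : (0 : ℝ) < d := by linarith
  have hdcast : ((d - 1 : ℕ) : ℝ) = d - 1 := by
    rw [Nat.cast_sub (by omega)]
    simp
  have hn₁le := initial_length_le hB1 hL1 hσ hσB hc hΛpos hΛle (x := n₁) (by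
    rw [← hc', ← hτ₁, ← hτ₂, hn₁]
    exact (Nat.ceil_lt_add_one (by positivity)).le)
  have hn₂le := doubling_length_le hB1 hσ hσB hτ₂ hζge (x := n₂)
    (Nat.ceil_lt_add_one (by positivity)).le
  have hhorR : (p'.horizon : ℝ) = n₁ + (d - 1) * (n₁ + n₁) +
      j * (d - 1) * ((d - 1) * (n₂ + n₂)) := by
    rw [hhor', hhor]
    push_cast
    rw [hdcast]
  rw [hhorR, hL]
  rw [hL] at hL1 hjle hn₁le
  exact total_length_le hd1 hB1 hL1 hσ hc (Nat.cast_nonneg _) (Nat.cast_nonneg _)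
    (Nat.cast_nonneg _) hn₁le hn₂le hjle

/-! ### Both claims from one policy -/

theorem mainTheorem1 :
    ∃ p : ℕ, ∀ K : ℝ, 0 < K → ∃ C : ℝ, 0 < C ∧
      ∀ (d : ℕ), 0 < d →
      ∀ (μ : Measure (EuclideanSpace ℝ (Fin d))) [IsProbabilityMeasure μ] (c ε σ : ℝ),
        PriorAssumption μ c ε σ K →
        (∀ lam : ℝ, 0 < lam → lam ≤ 1 → lam ≤ σ / d →
          ∃ alg : BanditAlgorithm d,
            alg.IsBIC μ ∧ alg.SpectrallyExplores μ lam ∧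
            (alg.horizon : ℝ) ≤
              C * max 1 (Real.log (1 / (σ * ε * c))) *
                ((d : ℝ) ^ 5 / (lam ^ 4 * σ ^ 2) + (d : ℝ) ^ 4 / (c ^ 2 * lam ^ 4)) ∧
            ∀ lamBar : ℝ, 0 < lamBar →
              (alg.repeatRuns ⌈lamBar / lam⌉₊).IsBIC μ ∧
              (alg.repeatRuns ⌈lamBar / lam⌉₊).SpectrallyExplores μ lamBar) ∧
        (∀ lamBar : ℝ, 0 < lamBar →
          ∃ alg : BanditAlgorithm d,
            alg.IsBIC μ ∧ alg.SpectrallyExplores μ lamBar ∧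
            (alg.horizon : ℝ) ≤
              C * max 1 lamBar * ((d : ℝ) / min σ c) ^ p * Real.log (1 / ε)) := by
  -- The exponent is `6` from `d² / σ⁶ + d / c²`, plus `1` from bounding the logarithms of `1 / σ`
  -- and `1 / c` by `d / min σ c`.
  refine ⟨7, fun K hK => ?_⟩
  obtain ⟨B₀, hB₀⟩ := exists_momentBound K hK
  -- `1 ≤ B₀` is known only once some prior satisfies the assumption, while the constant must be
  -- positive beforehand.
  set B := max B₀ 1 with hBdef
  have hB1 : 1 ≤ B := le_max_right _ _
  have hB : 0 < B := by linarith
  refine ⟨28 * 10 ^ 9 * B ^ 13, by positivity, fun d hd μ _ c ε σ h => ?_⟩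
  have hM : MomentBound μ B := by
    have := hB₀ d μ c ε σ h
    rwa [hBdef, max_eq_left this.one_le]
  have hc := h.c_pos
  have hε := h.ε_pos
  have hσ := h.σ_pos
  obtain ⟨p, hp, hinf, hhor⟩ := exists_policy hd h hM
  have hexp : p.toAlg.SpectrallyExplores μ 1 := hinf.spectrallyExplores
  set L := max 1 (Real.log (1 / (σ * ε * c))) with hL
  have hL1 : 1 ≤ L := le_max_left _ _
  have hd1 : (1 : ℝ) ≤ d := by exact_mod_cast hd
  have hd0 : (0 : ℝ) < d := by linarith
  have hunit : ‖(EuclideanSpace.single ⟨0, hd⟩ 1 : EuclideanSpace ℝ (Fin d))‖ = 1 := by simp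
  -- The same policy serves every `lam ≤ 1`, since it explores at level `1`; a general level is
  -- reached by repetition.
  refine ⟨fun lam hlam hlam1 hlamσ => ⟨p.toAlg, hp.isBIC hM.integrable, hexp.mono hlam1, ?_,
    fun lamBar hlamBar => ⟨(hp.repeatRuns _).isBIC hM.integrable,
      (hexp.mono hlam1).repeatRuns ?_⟩⟩,
    fun lamBar hlamBar => ⟨p.toAlg.repeatRuns ⌈lamBar⌉₊, (hp.repeatRuns _).isBIC hM.integrable,
      hexp.repeatRuns (by rw [mul_one]; exact Nat.le_ceil _), ?_⟩⟩
  · refine hhor.trans ?_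
    have hlamσ' : lam ≤ σ := hlamσ.trans (div_le_self hσ.le hd1)
    have h1 : (d : ℝ) ^ 2 / σ ^ 6 ≤ (d : ℝ) ^ 5 / (lam ^ 4 * σ ^ 2) := by
      have e : σ ^ 6 = σ ^ 4 * σ ^ 2 := by ring
      rw [e]
      gcongr
      norm_num
    have h2 : (d : ℝ) / c ^ 2 ≤ (d : ℝ) ^ 4 / (c ^ 2 * lam ^ 4) := by
      gcongr
      · exact le_self_pow₀ hd1 (by norm_num)
      · exact mul_le_of_le_one_right (by positivity) (pow_le_one₀ hlam.le hlam1)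
    have h3 : 10 ^ 9 * B ^ 8 ≤ 28 * 10 ^ 9 * B ^ 13 := by
      have : B ^ 8 ≤ B ^ 13 := pow_le_pow_right₀ hB1 (by norm_num)
      nlinarith [pow_pos hB 8]
    gcongr
  · have := Nat.le_ceil (lamBar / lam)
    rwa [div_le_iff₀ hlam] at this
  · have hε2 := h.ε_le_half hunit
    have hσB := h.σ_le hM hunit
    set m := min σ c with hm
    have hm0 : 0 < m := lt_min hσ hc
    set x := (d : ℝ) / m with hx
    have hx0 : 0 < x := by positivity
    set ℓ := Real.log (1 / ε) with hℓ
    -- From `ε ≤ 1 / 2`. With `1 ≤ B * x` this absorbs all additive terms of the logarithmic factor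
    -- into a multiple of `x * ℓ`.
    have hℓ2 : 1 / 2 ≤ ℓ := by
      have h1 : Real.log 2 ≤ ℓ := by
        refine Real.log_le_log two_pos ?_
        rw [le_div_iff₀ hε]
        linarith
      linarith [Real.log_two_gt_d9]
    have hxB : 1 ≤ B * x := by
      rw [hx, mul_div_assoc', le_div_iff₀ hm0, one_mul]
      have : m ≤ B := (min_le_left _ _).trans hσB
      nlinarith
    have hinv : ∀ y : ℝ, m ≤ y → -Real.log y ≤ x := by
      intro y hy
      have hy0 : 0 < y := hm0.trans_le hy
      rw [← Real.log_inv]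
      calc Real.log y⁻¹ ≤ y⁻¹ := (Real.log_le_sub_one_of_pos (by positivity)).trans (by linarith)
        _ ≤ m⁻¹ := by gcongr
        _ ≤ x := by rw [hx, div_eq_mul_inv]; exact le_mul_of_one_le_left (by positivity) hd1
    have hLle : L ≤ 7 * B * (x * ℓ) := by
      have h1 : Real.log (1 / (σ * ε * c)) = ℓ - Real.log σ - Real.log c := by
        rw [hℓ, one_div, one_div, Real.log_inv, Real.log_inv, Real.log_mul (by positivity) hc.ne',
          Real.log_mul hσ.ne' hε.ne']
        ring
      have h2 : L ≤ 1 + ℓ + 2 * x := by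
        refine max_le (by linarith) ?_
        rw [h1]
        have := hinv σ (min_le_left _ _)
        have := hinv c (min_le_right _ _)
        linarith
      have h3 : ℓ ≤ B * x * ℓ := le_mul_of_one_le_left (by linarith) hxB
      have h4 : x ≤ 2 * (x * ℓ) := by nlinarith
      have h5 : x * ℓ ≤ B * (x * ℓ) := le_mul_of_one_le_left (by positivity) hB1
      linarith
    have hbr : (d : ℝ) ^ 2 / σ ^ 6 + d / c ^ 2 ≤ 2 * B ^ 4 * x ^ 6 := by
      have h1 : (d : ℝ) ^ 2 / σ ^ 6 ≤ x ^ 6 := by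
        rw [hx, div_pow]
        gcongr
        · norm_num
        · exact min_le_left _ _
      have h2 : (d : ℝ) / c ^ 2 ≤ x ^ 2 := by
        rw [hx, div_pow]
        gcongr
        · exact le_self_pow₀ hd1 (by norm_num)
        · exact min_le_right _ _
      have h3 : x ^ 2 ≤ B ^ 4 * x ^ 6 := by
        have e : B ^ 4 * x ^ 6 = (B * x) ^ 4 * x ^ 2 := by ring
        rw [e]
        exact le_mul_of_one_le_left (by positivity) (one_le_pow₀ hxB)
      have h4 : x ^ 6 ≤ B ^ 4 * x ^ 6 :=
        le_mul_of_one_le_left (by positivity) (one_le_pow₀ hB1)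
      linarith
    have hN : (⌈lamBar⌉₊ : ℝ) ≤ 2 * max 1 lamBar := by
      have h1 := Nat.ceil_lt_add_one hlamBar.le
      have h2 := le_max_left 1 lamBar
      have h3 := le_max_right 1 lamBar
      linarith
    have hcast : ((p.toAlg.repeatRuns ⌈lamBar⌉₊).horizon : ℝ) = ⌈lamBar⌉₊ * p.horizon := by
      change ((⌈lamBar⌉₊ * p.horizon : ℕ) : ℝ) = _
      push_cast
      rfl
    have hhor' : (p.horizon : ℝ) ≤ 10 ^ 9 * B ^ 8 * L * ((d : ℝ) ^ 2 / σ ^ 6 + d / c ^ 2) := hhor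
    have hmax0 : (0 : ℝ) ≤ 2 * max 1 lamBar := by positivity
    rw [hcast]
    calc (⌈lamBar⌉₊ : ℝ) * p.horizon
        ≤ 2 * max 1 lamBar * (10 ^ 9 * B ^ 8 * (7 * B * (x * ℓ)) * (2 * B ^ 4 * x ^ 6)) := by
          refine mul_le_mul hN (hhor'.trans ?_) (Nat.cast_nonneg _) hmax0
          gcongr
      _ = 28 * 10 ^ 9 * B ^ 13 * max 1 lamBar * x ^ 7 * ℓ := by ring
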